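/- Let $M$ be a smooth 4-manifold with a smooth Lorentzian metric $g$ of signature $(-,+,+,+)$, and let $\{f_j\}_{j\in J}$ be a discretely labelled family of smooth complex solutions of the massless Klein-Gordon equation $\partial_\mu(\sqrt{-g}\,g^{\mu\nu}\partial_\nu f)=0$ on $M$ (for instance a complete set of Klein-Gordon-orthonormal modes). Let $\mathcal H$ be the bosonic Fock space with one mode for each $j\in J$, with occupation number basis $|n\rangle$ ($n$ a finitely supported family of natural numbers indexed by $J$) and annihilation and creation operators $\hat a_j,\hat a_j^\dagger$, and let $\hat\phi=\sum_j(\hat a_jf_j+\hat a_j^\dagger f_j^*)$. For a tangent vector $n^\mu$ at $x\in M$ put $\mathcal N(f,h)=n^\mu\partial_\mu f(x)\;n^\nu\partial_\nu h(x)$. For null $n^\mu$ the contracted normal ordered stress-energy tensor is $$:\!\hat T_{\mu\nu}(x)\!:n^\mu n^\nu=\sum_{i,j}\big[\mathcal N(f_i,f_j)\hat a_i\hat a_j+\mathcal N(f_i,f_j^*)\hat a_j^\dagger\hat a_i+\mathcal N(f_i^*,f_j)\hat a_i^\dagger\hat a_j+\mathcal N(f_i^*,f_j^*)\hat a_i^\dagger\hat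 a_j^\dagger\big].$$ Let $\hat\rho$ be a density matrix, pure or mixed, i.e. a positive operator of trace one on $\mathcal H$, whose null energy expectation values exist: for every $x\in M$ and every null vector $n^\mu$ at $x$ the trace $$\mathrm{Tr}\big[\hat\rho:\!\hat T_{\mu\nu}(x)\!:n^\mu n^\nu\big]=\sum_{m,k}\langle k|\hat\rho|m\rangle\,\langle m|:\!\hat T_{\mu\nu}(x)\!:n^\mu n^\nu|k\rangle$$ over the occupation number basis converges absolutely. One says that $\hat\rho$ violates the null energy condition (NEC) if this expectation value is negative for some $x\in M$ and some null vector $n^\mu$ at $x$. For finitely supported $O=(O_k)_{k\in J}$, $O_k\in\mathbb C$, let $|O\rangle$ be the coherent state, $\langle n|O\rangle=e^{-\|O\|^2/2}\prod_kO_k^{n_k}/\sqrt{n_k!}$ with $\|O\|^2=\sum_k|O_k|^2$ (so that $\hat a_k|O\rangle=O_k|O\rangle$). For two such amplitudes $O^{(i)},O^{(j)}$ put $$F_{ij}=\sum_k\big(f_kO^{(j)}_k+f_k^*O^{(i)*}_k\big),\qquad \rho_{ji}=\frac{\langle O^{(j)}|\hat\rho|O^{(i)}\rangle}{\langle O^{(j)}|O^{(i)}\rangle}.$$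 The sum over the (continuous, overcomplete) family of all coherent states is understood as the integral with the measure of the completeness relation $\int\prod_k\frac{d^2O_k}{\pi}|O\rangle\langle O|=1$. That is, $$\sum_{i,j}\mathrm{Re}\big[\rho_{ji}\,\mathcal N(F_{ij}(x),F_{ij}(x))\big]e^{-\|O^{(i)}-O^{(j)}\|^2}$$ $$:=\lim_{S}\int_{\mathbb C^S}\int_{\mathbb C^S}\mathrm{Re}\big[\rho_{ji}\,\mathcal N(F_{ij}(x),F_{ij}(x))\big]e^{-\|O^{(i)}-O^{(j)}\|^2}\prod_{k\in S}\frac{d^2O^{(i)}_k}{\pi}\frac{d^2O^{(j)}_k}{\pi},$$ where $S$ runs through the finite subsets of $J$, directed by inclusion, and amplitudes in $\mathbb C^S$ are extended by zero. Then for every $x\in M$ and every null vector $n^\mu$ at $x$ all these integrals converge absolutely and the limit exists in $\mathbb R$; and $\hat\rho$ violates NEC if and only if there exist a point $x\in M$ and a null vector $n^\mu$ at $x$ such that $$\sum_{i,j}\mathrm{Re}\big[\rho_{ji}\,\mathcal N(F_{ij}(x),F_{ij}(x))\big]e^{-\|O^{(i)}-O^{(j)}\|^2}<0.$$ -/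

import Mathlib

open scoped Manifold ContDiff Topology ComplexConjugate
open MeasureTheory Filter

noncomputable section

/-! ### Spacetime and the classical massless scalar field -/

/-- The model space `ℝ⁴` of a four-dimensional spacetime. -/
abbrev ModelSpace : Type := EuclideanSpace ℝ (Fin 4)

/-- A smooth metric of signature `(-,+,+,+)` on a smooth 4-manifold. -/
structure LorentzianMetric (M : Type*) [TopologicalSpace M] [ChartedSpace ModelSpace M]
    [IsManifold 𝓘(ℝ, ModelSpace) ∞ M] where
  /-- the bilinear form `g_x` on the tangent space at `x` -/
  val (x : M) : TangentSpace 𝓘(ℝ, ModelSpace) x →L[ℝ] TangentSpace 𝓘(ℝ, ModelSpace) x →L[ℝ] ℝ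
  symm (x : M) (v w : TangentSpace 𝓘(ℝ, ModelSpace) x) : val x v w = val x w v
  signature (x : M) : ∃ b : Module.Basis (Fin 4) ℝ (TangentSpace 𝓘(ℝ, ModelSpace) x),
    ∀ μ ν, val x (b μ) (b ν) = if μ = ν then (if μ = 0 then -1 else 1) else 0
  smooth : ContMDiff 𝓘(ℝ, ModelSpace)
    (𝓘(ℝ, ModelSpace).prod 𝓘(ℝ, ModelSpace →L[ℝ] ModelSpace →L[ℝ] ℝ)) ∞
    (fun x ↦ Bundle.TotalSpace.mk' (ModelSpace →L[ℝ] ModelSpace →L[ℝ] ℝ) x (val x))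

section Spacetime

variable {M : Type*} [TopologicalSpace M] [ChartedSpace ModelSpace M]
  [IsManifold 𝓘(ℝ, ModelSpace) ∞ M]

/-- `n` is a null vector at `x`: `g_{μν}(x) n^μ n^ν = 0`. -/
def LorentzianMetric.IsNull (g : LorentzianMetric M) (x : M)
    (n : TangentSpace 𝓘(ℝ, ModelSpace) x) : Prop :=
  g.val x n n = 0

/-- The `μ`-th coordinate vector of `ℝ⁴`. -/
def coordVec (μ : Fin 4) : ModelSpace := EuclideanSpace.single μ 1

/-- The matrix `g_{μν}` of the metric in the coordinates given by the chart around `p`, at the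
coordinate point `y`. -/
def LorentzianMetric.chartMatrix (g : LorentzianMetric M) (p : M) (y : ModelSpace) :
    Matrix (Fin 4) (Fin 4) ℝ := fun μ ν =>
  g.val ((extChartAt 𝓘(ℝ, ModelSpace) p).symm y)
    (mfderiv 𝓘(ℝ, ModelSpace) 𝓘(ℝ, ModelSpace) (extChartAt 𝓘(ℝ, ModelSpace) p).symm y
      (coordVec μ))
    (mfderiv 𝓘(ℝ, ModelSpace) 𝓘(ℝ, ModelSpace) (extChartAt 𝓘(ℝ, ModelSpace) p).symm y
      (coordVec ν))

/-- The density `√(-g) g^{μν} ∂_ν f` in the chart around `p`. -/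
def LorentzianMetric.chartFlux (g : LorentzianMetric M) (f : M → ℂ) (p : M) (μ : Fin 4)
    (y : ModelSpace) : ℂ :=
  ∑ ν : Fin 4, ((Real.sqrt (-(g.chartMatrix p y).det) * (g.chartMatrix p y)⁻¹ μ ν : ℝ) : ℂ) *
    fderiv ℝ (fun z => f ((extChartAt 𝓘(ℝ, ModelSpace) p).symm z)) y (coordVec ν)

/-- `f` is a smooth complex solution of the massless Klein-Gordon equation
`∂_μ (√(-g) g^{μν} ∂_ν f) = 0`, the Euler-Lagrange equation of the action
`-½ ∫ √(-g) g^{μν} ∂_μ φ ∂_ν φ`. -/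
def IsKleinGordonSolution (g : LorentzianMetric M) (f : M → ℂ) : Prop :=
  ContMDiff 𝓘(ℝ, ModelSpace) 𝓘(ℝ, ℂ) ∞ f ∧
  ∀ p : M, ∀ y ∈ (extChartAt 𝓘(ℝ, ModelSpace) p).target,
    ∑ μ : Fin 4, fderiv ℝ (g.chartFlux f p μ) y (coordVec μ) = 0

/-- `n^μ ∂_μ f (x)`. -/
def dirDeriv (f : M → ℂ) (x : M) (n : TangentSpace 𝓘(ℝ, ModelSpace) x) : ℂ :=
  (mfderiv 𝓘(ℝ, ModelSpace) 𝓘(ℝ, ℂ) f x n : ℂ)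

/-- `𝒩(f, h) = n^μ ∂_μ f · n^ν ∂_ν h` at the point `x`. -/
def nullProd (f h : M → ℂ) (x : M) (n : TangentSpace 𝓘(ℝ, ModelSpace) x) : ℂ :=
  dirDeriv f x n * dirDeriv h x n

/-- The complex conjugate function. -/
def conjFun (f : M → ℂ) : M → ℂ := fun x => conj (f x)

end Spacetime

/-! ### Fock space -/

/-- The bosonic Fock space over modes labelled by `J`, in the occupation number representation:
a vector is a square summable family of amplitudes indexed by the occupation numbers `J →₀ ℕ`. -/
abbrev FockSp (J : Type*) : Type _ := lp (fun _ : J →₀ ℕ => ℂ) 2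

section Fock

variable {J : Type*}

/-- The annihilation operator `a_j` on occupation number amplitudes:
`(a_j ψ)(n) = √(n_j + 1) ψ(n + e_j)`. -/
def annih (j : J) (ψ : (J →₀ ℕ) → ℂ) : (J →₀ ℕ) → ℂ := fun n =>
  (Real.sqrt (n j + 1) : ℂ) * ψ (n + Finsupp.single j 1)

/-- The creation operator `a_j†` on occupation number amplitudes:
`(a_j† ψ)(n) = √(n_j) ψ(n - e_j)`, which vanishes if `n_j = 0`. -/
def creat (j : J) (ψ : (J →₀ ℕ) → ℂ) : (J →₀ ℕ) → ℂ := fun n =>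
  (Real.sqrt (n j) : ℂ) * ψ (n - Finsupp.single j 1)

open Classical in
/-- The occupation number state `|n⟩`. -/
def numState (n : J →₀ ℕ) : FockSp J := lp.single 2 n (1 : ℂ)

/-- The squared norm `‖O‖² = ∑_j |O_j|²` of a finitely supported amplitude. -/
def ampNormSq (O : J →₀ ℂ) : ℝ := O.sum fun _ z => ‖z‖ ^ 2

/-- The occupation number amplitudes of the coherent state `|O⟩`:
`⟨n|O⟩ = e^{-‖O‖²/2} ∏_j O_j^{n_j} / √(n_j!)`. -/
def coherentAmp (O : J →₀ ℂ) (n : J →₀ ℕ) : ℂ :=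
  (Real.exp (-(ampNormSq O) / 2) : ℂ) *
    n.prod fun j k => O j ^ k / (Real.sqrt (k.factorial) : ℂ)

/-- Coherent states are eigenstates of the annihilation operators: `a_j |O⟩ = O_j |O⟩`. -/
theorem annih_coherentAmp (O : J →₀ ℂ) (j : J) :
    annih j (coherentAmp O) = fun n => O j * coherentAmp O n := by
  classical
  funext n
  have key : ∀ m : J →₀ ℕ, (m.prod fun j k => O j ^ k / (Real.sqrt (k.factorial) : ℂ)) =
      (O j ^ (m j) / (Real.sqrt ((m j).factorial) : ℂ)) *
        (m.erase j).prod fun j k => O j ^ k / (Real.sqrt (k.factorial) : ℂ) := by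
    intro m
    exact (Finsupp.mul_prod_erase' m j (fun j k => O j ^ k / (Real.sqrt (k.factorial) : ℂ))
      (by intro i; simp)).symm
  unfold annih coherentAmp
  rw [key n, key (n + Finsupp.single j 1)]
  have e : (n + Finsupp.single j 1).erase j = n.erase j := by
    rw [Finsupp.erase_add, Finsupp.erase_single, add_zero]
  have hs : (Real.sqrt (((n j + 1).factorial : ℕ) : ℝ) : ℂ) =
      (Real.sqrt (n j + 1) : ℂ) * (Real.sqrt ((n j).factorial : ℝ) : ℂ) := by
    rw [← Complex.ofReal_mul, ← Real.sqrt_mul (by positivity), Nat.factorial_succ]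
    push_cast
    rfl
  have h1 : (Real.sqrt ((n j : ℝ) + 1) : ℂ) ≠ 0 := by
    rw [Complex.ofReal_ne_zero]; positivity
  have h2 : (Real.sqrt ((n j).factorial : ℝ) : ℂ) ≠ 0 := by
    rw [Complex.ofReal_ne_zero]; positivity
  rw [e]
  simp only [Finsupp.add_apply, Finsupp.single_eq_same]
  rw [hs, pow_succ]
  field_simp

/-- The amplitudes of a coherent state are square summable. -/
theorem memℓp_coherentAmp (O : J →₀ ℂ) : Memℓp (coherentAmp O) 2 := by
  classical
  have hterm : ∀ (j : J) (k : ℕ), ‖O j ^ k / (Real.sqrt (k.factorial) : ℂ)‖ ^ 2 =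
      (‖O j‖ ^ 2) ^ k / k.factorial := by
    intro j k
    rw [norm_div, norm_pow, div_pow, Complex.norm_real, Real.norm_eq_abs, sq_abs,
      Real.sq_sqrt (by positivity)]
    ring
  rw [memℓp_gen_iff (by norm_num)]
  simp only [ENNReal.toReal_ofNat, Real.rpow_ofNat]
  unfold coherentAmp
  simp only [norm_mul, mul_pow]
  apply Summable.mul_left
  refine summable_of_sum_le (c := ∏ j ∈ O.support, Real.exp (‖O j‖ ^ 2))
    (fun n => by positivity) ?_
  intro A
  -- discard the occupation numbers of modes with vanishing amplitude
  set B := A.filter (fun n => n.support ⊆ O.support) with hB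
  have hAB : ∑ n ∈ A, ‖n.prod fun j k => O j ^ k / (Real.sqrt (k.factorial) : ℂ)‖ ^ 2 =
      ∑ n ∈ B, ‖n.prod fun j k => O j ^ k / (Real.sqrt (k.factorial) : ℂ)‖ ^ 2 := by
    symm
    apply Finset.sum_subset (Finset.filter_subset _ _)
    intro n hn hnB
    have : ¬ n.support ⊆ O.support := fun h => hnB (Finset.mem_filter.2 ⟨hn, h⟩)
    obtain ⟨j, hj, hjO⟩ := Finset.not_subset.1 this
    have h0 : (n.prod fun j k => O j ^ k / (Real.sqrt (k.factorial) : ℂ)) = 0 := by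
      apply Finset.prod_eq_zero hj
      change O j ^ n j / _ = 0
      rw [Finsupp.notMem_support_iff.1 hjO, zero_pow (Finsupp.mem_support_iff.1 hj), zero_div]
    rw [h0]; simp
  rw [hAB]
  have hval : ∀ n ∈ B, ‖n.prod fun j k => O j ^ k / (Real.sqrt (k.factorial) : ℂ)‖ ^ 2 =
      ∏ j : O.support, (‖O j‖ ^ 2) ^ (n j) / (n j).factorial := by
    intro n hn
    rw [Finsupp.prod_of_support_subset n (Finset.mem_filter.1 hn).2 _ (by intro i _; simp),
      norm_prod, ← Finset.prod_pow, ← Finset.prod_coe_sort]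
    exact Finset.prod_congr rfl fun j _ => hterm j (n j)
  rw [Finset.sum_congr rfl hval]
  set K := B.sup (fun n => n.sum fun _ k => k) + 1 with hK
  let r : (J →₀ ℕ) → (O.support → ℕ) := fun n j => n j
  have hinj : Set.InjOn r B := by
    intro n hn m hm h
    ext j
    by_cases hj : j ∈ O.support
    · exact congrFun h ⟨j, hj⟩
    · have h1 := fun h => hj ((Finset.mem_filter.1 hn).2 h)
      have h2 := fun h => hj ((Finset.mem_filter.1 hm).2 h)
      rw [Finsupp.notMem_support_iff.1 h1, Finsupp.notMem_support_iff.1 h2]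
  have himg : B.image r ⊆ Fintype.piFinset (fun _ : O.support => Finset.range K) := by
    intro q hq
    obtain ⟨n, hn, rfl⟩ := Finset.mem_image.1 hq
    rw [Fintype.mem_piFinset]
    intro j
    rw [Finset.mem_range, hK, Nat.lt_succ_iff]
    refine le_trans ?_ (Finset.le_sup (f := fun n : J →₀ ℕ => n.sum fun _ k => k) hn)
    by_cases hj : (j : J) ∈ n.support
    · exact Finset.single_le_sum (f := fun i => n i) (fun _ _ => Nat.zero_le _) hj
    · simp only [r]; rw [Finsupp.notMem_support_iff.1 hj]; exact Nat.zero_le _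
  have hstep : ∑ n ∈ B, ∏ j : O.support, (‖O j‖ ^ 2) ^ (n j) / ((n j).factorial : ℝ) =
      ∑ q ∈ B.image r, ∏ j : O.support, (‖O j‖ ^ 2) ^ (q j) / ((q j).factorial : ℝ) := by
    rw [Finset.sum_image hinj]
  rw [hstep]
  refine (Finset.sum_le_sum_of_subset_of_nonneg himg
    (fun _ _ _ => by positivity)).trans ?_
  rw [← Finset.prod_univ_sum (fun _ : O.support => Finset.range K)
    (fun j k => (‖O j‖ ^ 2) ^ k / (k.factorial : ℝ)), ← Finset.prod_coe_sort O.support]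
  exact Finset.prod_le_prod (fun _ _ => by positivity)
    (fun j _ => Real.sum_le_exp_of_nonneg (by positivity) K)

/-- The coherent state `|O⟩` with amplitudes `O_j`, finitely many of them non-zero. -/
def coherent (O : J →₀ ℂ) : FockSp J := ⟨coherentAmp O, memℓp_coherentAmp O⟩

/-- A (pure or mixed) density matrix: a positive operator of trace one. -/
def IsDensityMatrix (ρ : FockSp J →L[ℂ] FockSp J) : Prop :=
  ρ.IsPositive ∧ HasSum (fun n : J →₀ ℕ => inner ℂ (numState n) (ρ (numState n))) 1

end Fock

/-! ### The null energy condition -/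

section NEC

variable {M : Type*} [TopologicalSpace M] [ChartedSpace ModelSpace M]
  [IsManifold 𝓘(ℝ, ModelSpace) ∞ M] {J : Type*}

/-- The matrix element `⟨m| :T_{μν}(x): n^μ n^ν |k⟩` of the contracted normal ordered
stress-energy tensor of the field `φ = ∑_j (a_j f_j + a_j† f_j^*)` between occupation number states.
For given `m`, `k` only finitely many terms of the sum are non-zero. -/
def stressMatrix (f : J → M → ℂ) (x : M) (n : TangentSpace 𝓘(ℝ, ModelSpace) x)
    (m k : J →₀ ℕ) : ℂ :=
  ∑' p : J × J,
    (nullProd (f p.1) (f p.2) x n * annih p.1 (annih p.2 (numState k)) m +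
     nullProd (f p.1) (conjFun (f p.2)) x n * creat p.2 (annih p.1 (numState k)) m +
     nullProd (conjFun (f p.1)) (f p.2) x n * creat p.1 (annih p.2 (numState k)) m +
     nullProd (conjFun (f p.1)) (conjFun (f p.2)) x n * creat p.1 (creat p.2 (numState k)) m)

/-- The terms `⟨k|ρ|m⟩ ⟨m| :T_{μν}(x): n^μ n^ν |k⟩` whose sum is `Tr[ρ :T_{μν}(x): n^μ n^ν]`. -/
def stressTraceTerm (ρ : FockSp J →L[ℂ] FockSp J) (f : J → M → ℂ) (x : M)
    (n : TangentSpace 𝓘(ℝ, ModelSpace) x) (q : (J →₀ ℕ) × (J →₀ ℕ)) : ℂ :=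
  inner ℂ (numState q.1) (ρ (numState q.2)) * stressMatrix f x n q.2 q.1

/-- The expectation value `⟨:T_{μν}(x): n^μ n^ν⟩ = Tr[ρ :T_{μν}(x): n^μ n^ν]`. -/
def stressExpectation (ρ : FockSp J →L[ℂ] FockSp J) (f : J → M → ℂ) (x : M)
    (n : TangentSpace 𝓘(ℝ, ModelSpace) x) : ℂ :=
  ∑' q, stressTraceTerm ρ f x n q

/-- The null energy expectation values of `ρ` exist: the trace converges absolutely in the
occupation number basis at every point and for every null vector. -/
def HasStressExpectation (g : LorentzianMetric M) (ρ : FockSp J →L[ℂ] FockSp J)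
    (f : J → M → ℂ) : Prop :=
  ∀ (x : M) (n : TangentSpace 𝓘(ℝ, ModelSpace) x), g.IsNull x n →
    Summable (stressTraceTerm ρ f x n)

/-- `ρ` violates the null energy condition: the (real) expectation value of
`:T_{μν}(x): n^μ n^ν` is negative at some point `x` for some null vector `n`. -/
def ViolatesNEC (g : LorentzianMetric M) (ρ : FockSp J →L[ℂ] FockSp J) (f : J → M → ℂ) : Prop :=
  ∃ (x : M) (n : TangentSpace 𝓘(ℝ, ModelSpace) x), g.IsNull x n ∧
    (stressExpectation ρ f x n).re < 0

/-! ### The double sum over coherent states -/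

/-- `F_{12} = ∑_k (f_k O^{(2)}_k + f_k^* O^{(1)*}_k)`. -/
def crossFun (f : J → M → ℂ) (O₁ O₂ : J →₀ ℂ) : M → ℂ := fun x =>
  ∑ᶠ k : J, (f k x * O₂ k + conj (f k x) * conj (O₁ k))

/-- `ρ_{21} = ⟨O^{(2)}|ρ|O^{(1)}⟩ / ⟨O^{(2)}|O^{(1)}⟩`. -/
def coherentRatio (ρ : FockSp J →L[ℂ] FockSp J) (O₂ O₁ : J →₀ ℂ) : ℂ :=
  inner ℂ (coherent O₂) (ρ (coherent O₁)) / inner ℂ (coherent O₂) (coherent O₁)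

/-- The summand `Re[ρ_{21} 𝒩(F_{12}(x), F_{12}(x))] e^{-‖O^{(1)} - O^{(2)}‖²}`. -/
def coherentTerm (ρ : FockSp J →L[ℂ] FockSp J) (f : J → M → ℂ) (x : M)
    (n : TangentSpace 𝓘(ℝ, ModelSpace) x) (O₁ O₂ : J →₀ ℂ) : ℝ :=
  (coherentRatio ρ O₂ O₁ * nullProd (crossFun f O₁ O₂) (crossFun f O₁ O₂) x n).re *
    Real.exp (-ampNormSq (O₁ - O₂))

open Classical in
/-- Amplitudes on a finite set `S` of modes, extended by zero to all modes. -/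
def extendAmp (S : Finset J) (α : S → ℂ) : J →₀ ℂ :=
  Finsupp.onFinset S (fun j => if h : j ∈ S then α ⟨j, h⟩ else 0) (by
    intro j hj
    by_contra h
    exact hj (dif_neg h))

/-- The summand as a function of the amplitudes of two coherent states of the modes in `S`. -/
def coherentIntegrand (ρ : FockSp J →L[ℂ] FockSp J) (f : J → M → ℂ) (x : M)
    (n : TangentSpace 𝓘(ℝ, ModelSpace) x) (S : Finset J) (α : (S → ℂ) × (S → ℂ)) : ℝ :=
  coherentTerm ρ f x n (extendAmp S α.1) (extendAmp S α.2)

/-- The double sum `∑_{i,j} Re[ρ_{ji} 𝒩(F_{ij}(x), F_{ij}(x))] e^{-‖O^{(i)} - O^{(j)}‖²}` over the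
complete set of coherent states converges to `L`.

The coherent states form a continuous, overcomplete family. For finitely many modes `S` the sum
over them is the integral with respect to `∏_{k ∈ S} d²O_k / π`, normalised by the completeness
relation `∫ ∏_{k ∈ S} d²O_k / π |O⟩⟨O| = 1` on the Fock space of the modes in `S`; for arbitrarily
many modes it is the limit along the finite sets `S` of modes. -/
def CoherentDoubleSum (ρ : FockSp J →L[ℂ] FockSp J) (f : J → M → ℂ) (x : M)
    (n : TangentSpace 𝓘(ℝ, ModelSpace) x) (L : ℝ) : Prop :=
  (∀ S : Finset J, Integrable (coherentIntegrand ρ f x n S) volume) ∧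
  Tendsto (fun S : Finset J =>
    (Real.pi ^ (2 * S.card))⁻¹ * ∫ α, coherentIntegrand ρ f x n S α) atTop (𝓝 L)

end NEC

end

/-! Write `c j` for the derivative of `f j` along the null vector and `A = ∑ c j a_j`, the sum
running over a finite set `S` of modes. Coherent states on `S` are eigenvectors of `A`, with
eigenvalue `smear c S`. The squared overlap is `|⟨β|α⟩|² = exp(-‖α - β‖²)`, so the Gaussian factor
cancels the denominator of `coherentRatio`, and the summand becomes the real part of `⟨β|ρ|α⟩ ⟨α|β⟩
(smear β + conj (smear α))²`, that is, of `⟨β|ρ|α⟩ ⟨α| :(A + A†)²: |β⟩` (`coherentIntegrand_eq`). By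
completeness the normalised double integral is the trace of `ρ :T:` restricted to occupation numbers
supported in `S` (`integral_overlapIntegrand`). As `S` grows, these truncated traces tend to the
full trace by dominated convergence. The double sum thus equals the null energy expectation value,
and the two sign conditions agree.

The analytic work is to justify this for an unbounded observable and a general mixed state. For
absolute convergence, Cauchy-Schwarz for the positive form of `ρ` bounds `|⟨β|ρ|α⟩|` by a sum of two
Husimi functions. What remains is a Gaussian in `α - β` times a quadratic polynomial, so the bound
has the shape of a convolution integrand. It is integrable once the Husimi function has the second
moments weighted by `|c i|²`. These are controlled by the weighted mean occupation numbers, which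
are finite because the diagonal terms `2 p_k ∑ |c i|² k_i` of the trace are nonnegative and summable
(`integrable_overlapIntegrand`, `summable_occProb_mul`).

For the value, the integrals are exhausted by polydiscs. On a polydisc the occupation amplitudes are
still orthogonal, by rotation symmetry, and compactness allows termwise integration
(`hasSum_polydisc`). The truncation only inserts weights between 0 and 1 that tend to 1, so
dominated convergence applies once more. -/

/-! ### Coherent states of finitely many modes -/

section CoherentStates

variable {J : Type*}

/-- The occupation numbers that involve only the modes in `S`. -/
noncomputable def occSet (S : Finset J) : Set (J →₀ ℕ) := {n | n.support ⊆ S}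

/-- The label set `J` may be uncountable, whereas termwise integration needs countably many terms;
only occupation numbers in `occSet S` contribute. -/
theorem countable_occSet (S : Finset J) : (occSet S).Countable := by
  have hinj : Function.Injective (fun (n : occSet S) (j : S) => (n : J →₀ ℕ) j) := by
    intro n m h
    ext j
    by_cases hj : j ∈ S
    · exact congrFun h ⟨j, hj⟩
    · rw [Finsupp.notMem_support_iff.1 (fun h => hj (n.2 h)),
        Finsupp.notMem_support_iff.1 (fun h => hj (m.2 h))]
  exact Set.countable_coe_iff.1 hinj.countable

theorem extendAmp_apply_of_mem {S : Finset J} (α : S → ℂ) (j : S) : extendAmp S α j = α j := by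
  simp [extendAmp]

theorem extendAmp_apply_of_notMem {S : Finset J} (α : S → ℂ) {j : J} (hj : j ∉ S) :
    extendAmp S α j = 0 := by
  simp [extendAmp, hj]

theorem extendAmp_support_subset {S : Finset J} (α : S → ℂ) : (extendAmp S α).support ⊆ S :=
  Finsupp.support_onFinset_subset

theorem extendAmp_sub {S : Finset J} (α β : S → ℂ) :
    extendAmp S α - extendAmp S β = extendAmp S (α - β) := by
  ext j
  by_cases hj : j ∈ S
  · simp [extendAmp, hj]
  · simp [extendAmp, hj]

theorem ampNormSq_extendAmp {S : Finset J} (α : S → ℂ) :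
    ampNormSq (extendAmp S α) = ∑ j, ‖α j‖ ^ 2 := by
  rw [ampNormSq, Finsupp.sum_of_support_subset _ (extendAmp_support_subset α) _ (by simp),
    ← Finset.sum_coe_sort]
  simp only [extendAmp_apply_of_mem]

/-- The amplitude `⟨k|z⟩` of a one mode coherent state. -/
noncomputable def modeAmp (k : ℕ) (z : ℂ) : ℂ :=
  z ^ k / (Real.sqrt k.factorial : ℂ) * (Real.exp (-‖z‖ ^ 2 / 2) : ℂ)

theorem continuous_modeAmp (k : ℕ) : Continuous (modeAmp k) := by
  unfold modeAmp; fun_prop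

/-- The Gaussian normalisation splits over the modes, which makes integrals over amplitudes products
of one-mode integrals. -/
theorem coherentAmp_extendAmp {S : Finset J} (α : S → ℂ) {n : J →₀ ℕ} (hn : n ∈ occSet S) :
    coherentAmp (extendAmp S α) n = ∏ j : S, modeAmp (n j) (α j) := by
  unfold coherentAmp modeAmp
  rw [Finset.prod_mul_distrib, ampNormSq_extendAmp,
    Finsupp.prod_of_support_subset n hn _ (by simp), ← Finset.prod_coe_sort, mul_comm]
  simp only [extendAmp_apply_of_mem]
  congr 1
  rw [← Complex.ofReal_prod, ← Real.exp_sum, ← Finset.sum_neg_distrib, Finset.sum_div]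

theorem coherentAmp_extendAmp_of_notMem {S : Finset J} (α : S → ℂ) {n : J →₀ ℕ}
    (hn : n ∉ occSet S) : coherentAmp (extendAmp S α) n = 0 := by
  obtain ⟨j, hj, hjS⟩ := Finset.not_subset.1 hn
  unfold coherentAmp
  rw [Finsupp.prod, Finset.prod_eq_zero hj, mul_zero]
  rw [extendAmp_apply_of_notMem _ hjS, zero_pow (Finsupp.mem_support_iff.1 hj), zero_div]

theorem continuous_coherentAmp_extendAmp (S : Finset J) (n : J →₀ ℕ) :
    Continuous fun α : S → ℂ => coherentAmp (extendAmp S α) n := by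
  by_cases hn : n ∈ occSet S
  · simp only [coherentAmp_extendAmp _ hn]
    exact continuous_finsetProd _ fun j _ => (continuous_modeAmp _).comp (continuous_apply j)
  · simp only [coherentAmp_extendAmp_of_notMem _ hn]
    exact continuous_const

open Classical in
/-- Splitting off the occupation number of one mode. -/
noncomputable def occSetInsert {S : Finset J} {j : J} (hj : j ∉ S) :
    occSet (insert j S) ≃ ℕ × occSet S where
  toFun n := (n.1 j, ⟨n.1.erase j, by
    have := n.2
    simp only [occSet, Set.mem_ofPred_eq, Finsupp.support_erase] at this ⊢
    rwa [← Finset.subset_insert_iff]⟩)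
  invFun p := ⟨Finsupp.single j p.1 + p.2.1, by
    refine Finsupp.support_add.trans (Finset.union_subset ?_ (p.2.2.trans
      (Finset.subset_insert _ _)))
    exact Finsupp.support_single_subset.trans (by simp)⟩
  left_inv n := by ext1; exact Finsupp.single_add_erase j n.1
  right_inv p := by
    have h : (p.2 : J →₀ ℕ) j = 0 := Finsupp.notMem_support_iff.1 fun h => hj (p.2.2 h)
    ext i
    · simp [h]
    · by_cases hi : i = j
      · subst hi; simp [h]
      · simp [Finsupp.erase_ne hi]

/-- The exponential series in finitely many variables. -/
theorem hasSum_prod_pow_div_factorial (x : J → ℂ) (S : Finset J) :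
    HasSum (fun n : occSet S => ∏ j ∈ S, x j ^ (n : J →₀ ℕ) j / ((n : J →₀ ℕ) j).factorial)
      (Complex.exp (∑ j ∈ S, x j)) := by
  classical
  induction S using Finset.induction_on with
  | empty =>
    have : Unique (occSet (∅ : Finset J)) :=
      { default := ⟨0, by simp [occSet]⟩
        uniq := fun n => by
          ext1
          have := n.2
          simpa [occSet] using this }
    simp only [Finset.prod_empty, Finset.sum_empty, Complex.exp_zero]
    convert! hasSum_fintype (fun _ : occSet (∅ : Finset J) => (1 : ℂ)) using 1
    simp
  | insert j S hj ih =>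
    have h1 : HasSum (fun k : ℕ => x j ^ k / (k.factorial : ℂ)) (Complex.exp (x j)) := by
      rw [Complex.exp_eq_exp_ℂ]
      exact NormedSpace.expSeries_div_hasSum_exp (x j)
    rw [Finset.sum_insert hj, Complex.exp_add, ← (occSetInsert hj).symm.hasSum_iff]
    -- Absolute convergence of both factors makes their double series summable.
    have h2 := summable_mul_of_summable_norm h1.summable.norm ih.summable.norm
    convert! HasSum.mul h1 ih h2 using 1
    funext ⟨k, n⟩
    have hnj : (n : J →₀ ℕ) j = 0 := Finsupp.notMem_support_iff.1 fun h => hj (n.2 h)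
    simp only [Function.comp_apply, occSetInsert, Equiv.coe_fn_symm_mk, Finset.prod_insert hj]
    congr 1
    · simp [hnj]
    · refine Finset.prod_congr rfl fun i hi => ?_
      have : j ≠ i := fun h => hj (h ▸ hi)
      simp [this]

theorem conj_modeAmp_mul_modeAmp (k : ℕ) (z w : ℂ) :
    conj (modeAmp k z) * modeAmp k w =
      (Real.exp (-‖z‖ ^ 2 / 2) * Real.exp (-‖w‖ ^ 2 / 2) : ℝ) *
        ((conj z * w) ^ k / k.factorial) := by
  have h : (Real.sqrt k.factorial : ℂ) * (Real.sqrt k.factorial : ℂ) = k.factorial := by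
    rw [← Complex.ofReal_mul, Real.mul_self_sqrt (by positivity)]; simp
  unfold modeAmp
  rw [map_mul, map_div₀, map_pow, Complex.conj_ofReal, Complex.conj_ofReal, mul_pow, ← h]
  push_cast
  field_simp

/-- The overlap `⟨β|α⟩` of two coherent states. -/
theorem inner_coherent (S : Finset J) (β α : S → ℂ) :
    inner ℂ (coherent (extendAmp S β)) (coherent (extendAmp S α)) =
      (Real.exp (-(∑ j, ‖β j‖ ^ 2) / 2) * Real.exp (-(∑ j, ‖α j‖ ^ 2) / 2) : ℝ) *
        Complex.exp (∑ j, conj (β j) * α j) := by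
  have h := hasSum_prod_pow_div_factorial
    (fun j => conj (extendAmp S β j) * extendAmp S α j) S
  have h2 := (h.mul_left ((Real.exp (-(∑ j, ‖β j‖ ^ 2) / 2) *
    Real.exp (-(∑ j, ‖α j‖ ^ 2) / 2) : ℝ) : ℂ))
  rw [← Finset.sum_coe_sort S] at h2
  simp only [extendAmp_apply_of_mem] at h2
  refine (lp.hasSum_inner (𝕜 := ℂ) (coherent (extendAmp S β)) (coherent (extendAmp S α))).unique ?_
  rw [← hasSum_subtype_iff_of_support_subset (s := occSet S)]
  · refine h2.congr_fun fun n => ?_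
    have e : ∀ O : J →₀ ℂ, (coherent O : (J →₀ ℕ) → ℂ) = coherentAmp O := fun _ => rfl
    rw [Function.comp_apply, e, e, coherentAmp_extendAmp _ n.2, coherentAmp_extendAmp _ n.2,
      RCLike.inner_apply, mul_comm, map_prod, ← Finset.prod_mul_distrib]
    simp only [conj_modeAmp_mul_modeAmp]
    rw [Finset.prod_mul_distrib, ← Finset.prod_coe_sort S]
    simp only [extendAmp_apply_of_mem]
    congr 1
    rw [← Complex.ofReal_prod, Finset.prod_mul_distrib, ← Real.exp_sum, ← Real.exp_sum,
      ← Finset.sum_neg_distrib, Finset.sum_div, ← Finset.sum_neg_distrib, Finset.sum_div]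
  · intro n hn
    by_contra h
    apply hn
    have e : ∀ O : J →₀ ℂ, (coherent O : (J →₀ ℕ) → ℂ) = coherentAmp O := fun _ => rfl
    beta_reduce
    rw [e, e, coherentAmp_extendAmp_of_notMem _ h, inner_zero_left]

theorem inner_coherent_self (S : Finset J) (α : S → ℂ) :
    inner ℂ (coherent (extendAmp S α)) (coherent (extendAmp S α)) = (1 : ℂ) := by
  rw [inner_coherent]
  simp only [Complex.conj_mul']
  rw [← Real.exp_add]
  norm_cast
  rw [← Real.exp_add]
  simp

theorem norm_coherent (S : Finset J) (α : S → ℂ) : ‖coherent (extendAmp S α)‖ = 1 := by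
  rw [norm_eq_sqrt_re_inner (𝕜 := ℂ), inner_coherent_self]
  simp

/-- The real part of the exponent, `-(‖β‖² + ‖α‖²)/2 + Re ⟨β, α⟩`, completes to a square. -/
theorem norm_inner_coherent (S : Finset J) (β α : S → ℂ) :
    ‖inner ℂ (coherent (extendAmp S β)) (coherent (extendAmp S α))‖ =
      Real.exp (-(∑ j, ‖β j - α j‖ ^ 2) / 2) := by
  rw [inner_coherent, norm_mul, Complex.norm_real, Complex.norm_exp, Real.norm_of_nonneg
    (by positivity), ← Real.exp_add, ← Real.exp_add, Complex.re_sum]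
  congr 1
  rw [← add_div, ← neg_add, ← Finset.sum_add_distrib, ← Finset.sum_neg_distrib,
    ← Finset.sum_neg_distrib, Finset.sum_div, Finset.sum_div, ← Finset.sum_add_distrib]
  refine Finset.sum_congr rfl fun j _ => ?_
  rw [← Complex.normSq_eq_norm_sq, ← Complex.normSq_eq_norm_sq, ← Complex.normSq_eq_norm_sq,
    Complex.normSq_sub]
  simp only [Complex.normSq_apply, Complex.mul_re, Complex.conj_re, Complex.conj_im]
  ring

/-- For unit vectors the squared distance is `2 - 2 Re` of the overlap, and the overlap is explicit.
-/
theorem continuous_coherent (S : Finset J) :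
    Continuous fun α : S → ℂ => coherent (extendAmp S α) := by
  rw [continuous_iff_continuousAt]
  intro α₀
  rw [ContinuousAt, tendsto_iff_norm_sub_tendsto_zero]
  have h : ∀ α : S → ℂ, ‖coherent (extendAmp S α) - coherent (extendAmp S α₀)‖ =
      Real.sqrt (2 - 2 * (inner ℂ (coherent (extendAmp S α)) (coherent (extendAmp S α₀))).re) := by
    intro α
    rw [← Real.sqrt_sq (norm_nonneg _), norm_sub_sq (𝕜 := ℂ), norm_coherent, norm_coherent]
    congr 1
    simp only [RCLike.re_eq_complex_re]
    ring
  simp only [h]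
  have hc : Continuous fun α : S → ℂ =>
      Real.sqrt (2 - 2 * (inner ℂ (coherent (extendAmp S α)) (coherent (extendAmp S α₀))).re) := by
    simp only [inner_coherent]
    fun_prop
  convert hc.tendsto α₀ using 2
  rw [inner_coherent_self]
  simp

end CoherentStates

/-! ### Orthogonality of coherent amplitudes on polydiscs -/

section Orthogonality

variable {J : Type*}

theorem norm_modeAmp_sq (k : ℕ) (z : ℂ) :
    ‖modeAmp k z‖ ^ 2 =
      (k.factorial : ℝ)⁻¹ * (‖z‖ ^ ((2 * k : ℕ) : ℝ) * Real.exp (-‖z‖ ^ (2 : ℝ))) := by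
  have h := conj_modeAmp_mul_modeAmp k z z
  rw [Complex.conj_mul', Complex.conj_mul', ← Real.exp_add] at h
  norm_cast at h
  rw [h, Real.rpow_natCast, Real.rpow_ofNat, ← pow_mul]
  ring_nf

/-- The diagonal part of one-mode completeness: the radial integral is `Γ(k + 1) = k!`, which
cancels the normalisation of the amplitude. -/
theorem integral_norm_modeAmp_sq (k : ℕ) : ∫ z : ℂ, ‖modeAmp k z‖ ^ 2 = Real.pi := by
  simp only [norm_modeAmp_sq]
  rw [integral_const_mul, Complex.integral_rpow_mul_exp_neg_rpow (by norm_num)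
    (by linarith [Nat.cast_nonneg (α := ℝ) (2 * k)])]
  have : (((2 * k : ℕ) : ℝ) + 2) / 2 = k + 1 := by push_cast; ring
  rw [this, Real.Gamma_nat_eq_factorial]
  have : (k.factorial : ℝ) ≠ 0 := by positivity
  field_simp

theorem integrable_norm_modeAmp_sq (k : ℕ) : Integrable fun z : ℂ => ‖modeAmp k z‖ ^ 2 :=
  -- A non-integrable function has integral zero by convention, so a nonzero value already proves
  -- integrability.
  Integrable.of_integral_ne_zero (by rw [integral_norm_modeAmp_sq]; exact Real.pi_ne_zero)

/-- The weight of the occupation number `k` in the disc of radius `R`. -/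
noncomputable def modeWeight (R : ℝ) (k : ℕ) : ℝ :=
  Real.pi⁻¹ * ∫ z in Metric.closedBall (0 : ℂ) R, ‖modeAmp k z‖ ^ 2

theorem modeWeight_nonneg (R : ℝ) (k : ℕ) : 0 ≤ modeWeight R k :=
  mul_nonneg (by positivity) (integral_nonneg fun _ => by positivity)

theorem modeWeight_le_one (R : ℝ) (k : ℕ) : modeWeight R k ≤ 1 := by
  have h : ∫ z in Metric.closedBall (0 : ℂ) R, ‖modeAmp k z‖ ^ 2 ≤ Real.pi := by
    rw [← integral_norm_modeAmp_sq k]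
    exact setIntegral_le_integral (integrable_norm_modeAmp_sq k)
      (Eventually.of_forall fun _ => by positivity)
  unfold modeWeight
  rw [inv_mul_le_iff₀ Real.pi_pos, mul_one]
  exact h

theorem tendsto_modeWeight (k : ℕ) :
    Tendsto (fun N : ℕ => modeWeight N k) atTop (𝓝 1) := by
  have h := (aecover_closedBall (μ := volume) (x := (0 : ℂ))
    (tendsto_natCast_atTop_atTop (R := ℝ))).integral_tendsto_of_countably_generated
      (integrable_norm_modeAmp_sq k)
  rw [integral_norm_modeAmp_sq] at h
  have := h.const_mul Real.pi⁻¹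
  rwa [inv_mul_cancel₀ Real.pi_ne_zero] at this

/-- For `k ≠ l`, rotation by the angle `π / (k - l)` preserves the disc and multiplies the integrand
by `-1`, so the integral equals its own negative. -/
theorem setIntegral_conj_modeAmp_mul (R : ℝ) (k l : ℕ) :
    ∫ z in Metric.closedBall (0 : ℂ) R, conj (modeAmp k z) * modeAmp l z =
      if k = l then ((Real.pi * modeWeight R k : ℝ) : ℂ) else 0 := by
  split_ifs with h
  · subst h
    unfold modeWeight
    rw [mul_inv_cancel_left₀ Real.pi_ne_zero, ← integral_complex_ofReal]
    refine integral_congr_ae (Eventually.of_forall fun z => ?_)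
    simp [Complex.conj_mul']
  · set u : Circle := Circle.exp (Real.pi / ((k : ℝ) - l)) with hu
    have hkl : (k : ℝ) - l ≠ 0 := sub_ne_zero.2 (by exact_mod_cast h)
    have hphase : conj (u : ℂ) ^ k * (u : ℂ) ^ l = -1 := by
      rw [hu, Circle.coe_exp, ← Complex.exp_conj, ← Complex.exp_nat_mul, ← Complex.exp_nat_mul,
        ← Complex.exp_add]
      have hkl' : (k : ℂ) - l ≠ 0 := by exact_mod_cast hkl
      have : (k : ℂ) * conj (((Real.pi / ((k : ℝ) - l) : ℝ) : ℂ) * Complex.I) +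
          l * (((Real.pi / ((k : ℝ) - l) : ℝ) : ℂ) * Complex.I) = -(Real.pi * Complex.I) := by
        rw [map_mul, Complex.conj_ofReal, Complex.conj_I]
        push_cast
        field_simp
        ring
      rw [this, Complex.exp_neg, Complex.exp_pi_mul_I]
      norm_num
    have hmul : ∀ (j : ℕ) (z : ℂ), modeAmp j (rotation u z) = (u : ℂ) ^ j * modeAmp j z := by
      intro j z
      simp only [modeAmp, rotation_apply, norm_mul, Circle.norm_coe, one_mul, mul_pow]
      ring
    have hinv := (rotation u).measurePreserving.setIntegral_preimage_emb
      (rotation u).toHomeomorph.measurableEmbedding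
      (fun z => conj (modeAmp k z) * modeAmp l z) (Metric.closedBall (0 : ℂ) R)
    rw [LinearIsometryEquiv.preimage_closedBall, map_zero] at hinv
    have hneg : ∀ z, conj (modeAmp k (rotation u z)) * modeAmp l (rotation u z) =
        -(conj (modeAmp k z) * modeAmp l z) := by
      intro z
      rw [hmul, hmul, map_mul, map_pow, ← neg_one_mul, ← hphase]
      ring
    simp only [hneg, integral_neg] at hinv
    exact self_eq_neg.1 hinv.symm

/-- The weight of an occupation number in the polydisc of radius `R`. -/
noncomputable def occWeight (S : Finset J) (R : ℝ) (n : J →₀ ℕ) : ℝ := ∏ j ∈ S, modeWeight R (n j)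

theorem occWeight_nonneg (S : Finset J) (R : ℝ) (n : J →₀ ℕ) : 0 ≤ occWeight S R n :=
  Finset.prod_nonneg fun _ _ => modeWeight_nonneg _ _

theorem occWeight_le_one (S : Finset J) (R : ℝ) (n : J →₀ ℕ) : occWeight S R n ≤ 1 :=
  Finset.prod_le_one (fun _ _ => modeWeight_nonneg _ _) fun _ _ => modeWeight_le_one _ _

theorem tendsto_occWeight (S : Finset J) (n : J →₀ ℕ) :
    Tendsto (fun N : ℕ => occWeight S N n) atTop (𝓝 1) := by
  have := tendsto_finsetProd S fun j (_ : j ∈ S) => tendsto_modeWeight (n j)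
  simpa [occWeight] using this

-- A ball for the sup norm is a polydisc, so Fubini reduces the claim to single modes. Distinct
-- occupation numbers in `occSet S` differ at some mode of `S`, whose factor vanishes.
open Classical in
theorem setIntegral_conj_coherentAmp_mul (S : Finset J) {R : ℝ} (hR : 0 ≤ R) (k l : J →₀ ℕ) :
    ∫ α in Metric.closedBall (0 : S → ℂ) R,
      conj (coherentAmp (extendAmp S α) k) * coherentAmp (extendAmp S α) l =
    if k = l ∧ k ∈ occSet S then ((Real.pi ^ S.card * occWeight S R k : ℝ) : ℂ) else 0 := by
  by_cases hk : k ∈ occSet S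
  swap
  · simp [coherentAmp_extendAmp_of_notMem _ hk, hk]
  by_cases hl : l ∈ occSet S
  swap
  · have : k ≠ l := fun h => hl (h ▸ hk)
    simp [coherentAmp_extendAmp_of_notMem _ hl, this]
  simp only [coherentAmp_extendAmp _ hk, coherentAmp_extendAmp _ hl, map_prod,
    ← Finset.prod_mul_distrib]
  rw [closedBall_pi _ hR, volume_pi, Measure.restrict_pi_pi,
    integral_fintype_prod_eq_prod (fun (j : S) z => conj (modeAmp (k j) z) * modeAmp (l j) z)]
  simp only [Pi.zero_apply, setIntegral_conj_modeAmp_mul]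
  split_ifs with h
  · obtain ⟨rfl, -⟩ := h
    simp only [if_true]
    rw [← Complex.ofReal_prod, Finset.prod_mul_distrib, occWeight, ← Finset.prod_coe_sort S]
    simp
  · have : k ≠ l := fun h' => h ⟨h', hk⟩
    obtain ⟨j, hj⟩ := Finsupp.ne_iff.1 this
    have hjS : j ∈ S := by
      by_contra hjS
      apply hj
      rw [Finsupp.notMem_support_iff.1 fun h => hjS (hk h),
        Finsupp.notMem_support_iff.1 fun h => hjS (hl h)]
    exact Finset.prod_eq_zero (Finset.mem_univ (⟨j, hjS⟩ : S)) (if_neg hj)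

/-- Termwise integration over a compact set. -/
theorem hasSum_setIntegral_of_sum_norm_le {ι X : Type*} [TopologicalSpace X] [T2Space X]
    [MeasurableSpace X] [OpensMeasurableSpace X] {μ : Measure X} [IsFiniteMeasureOnCompacts μ]
    {K : Set X} (hK : IsCompact K) {F : ι → X → ℂ} {f : X → ℂ} {g : X → ℝ}
    (hF : ∀ i, Continuous (F i)) (hg : Continuous g) {s : Set ι} (hs : s.Countable)
    (hFs : ∀ i ∉ s, F i = 0) (hb : ∀ (A : Finset ι) x, ∑ i ∈ A, ‖F i x‖ ≤ g x)
    (hsum : ∀ x, HasSum (fun i => F i x) (f x)) :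
    HasSum (fun i => ∫ x in K, F i x ∂μ) (∫ x in K, f x ∂μ) := by
  have := hs.to_subtype
  have hint : ∀ i, IntegrableOn (F i) K μ := fun i => (hF i).continuousOn.integrableOn_compact hK
  rw [← hasSum_subtype_iff_of_support_subset (s := s)]
  · have h := hasSum_integral_of_summable_integral_norm (F := fun i : s => F i)
      (μ := μ.restrict K) (fun i => hint i) (by
        -- All partial sums of the integrated norms lie below the integral of `g` over `K`, which is
        -- finite by compactness.
        refine summable_of_sum_le (c := ∫ x in K, g x ∂μ)
          (fun i => integral_nonneg fun _ => norm_nonneg _) fun A => ?_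
        rw [← integral_finsetSum (f := fun (i : s) x => ‖F i x‖) A fun i _ => (hint i).norm]
        refine integral_mono (integrable_finsetSum _ fun i _ => (hint i).norm)
          (hg.continuousOn.integrableOn_compact hK) fun x => ?_
        have := hb (A.map (Function.Embedding.subtype _)) x
        simpa using this)
    convert! h using 1
    refine integral_congr_ae (Eventually.of_forall fun x => ?_)
    have h1 : HasSum ((fun i => F i x) ∘ ((↑) : s → ι)) (f x) := by
      rw [hasSum_subtype_iff_of_support_subset]
      · exact hsum x
      · intro i hi
        by_contra h
        exact hi (by simp [hFs i h])
    exact h1.tsum_eq.symm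
  · intro i hi
    by_contra h
    exact hi (by simp [hFs i h])

end Orthogonality

/-! ### Density matrices in the coherent state representation -/

section DensityMatrix

variable {J : Type*}

/-- The matrix element `⟨k|ρ|m⟩` between occupation number states. -/
noncomputable def entry (ρ : FockSp J →L[ℂ] FockSp J) (k m : J →₀ ℕ) : ℂ :=
  inner ℂ (numState k) (ρ (numState m))

/-- The probability `⟨k|ρ|k⟩` of the occupation number `k`. -/
noncomputable def occProb (ρ : FockSp J →L[ℂ] FockSp J) (k : J →₀ ℕ) : ℝ := (entry ρ k k).re

/-- The Husimi function `⟨α|ρ|α⟩`. -/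
noncomputable def husimi (ρ : FockSp J →L[ℂ] FockSp J) (S : Finset J) (α : S → ℂ) : ℝ :=
  (inner ℂ (coherent (extendAmp S α)) (ρ (coherent (extendAmp S α)))).re

-- A positive operator factors as `s* s`, which turns its form into an ordinary inner product and
-- gives access to Cauchy-Schwarz.
open ComplexOrder in
theorem exists_inner_eq_of_isPositive {E : Type*} [NormedAddCommGroup E] [InnerProductSpace ℂ E]
    [CompleteSpace E] {ρ : E →L[ℂ] E} (hρ : ρ.IsPositive) :
    ∃ s : E →L[ℂ] E, ∀ x y, inner ℂ x (ρ y) = inner ℂ (s x) (s y) := by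
  rw [← ContinuousLinearMap.nonneg_iff_isPositive] at hρ
  obtain ⟨s, rfl⟩ := CStarAlgebra.nonneg_iff_eq_star_mul_self.1 hρ
  exact ⟨s, fun x y => by
    rw [ContinuousLinearMap.star_eq_adjoint, mul_apply_eq_comp,
      ContinuousLinearMap.adjoint_inner_right]⟩

theorem norm_inner_le_sqrt_mul_sqrt {E : Type*} [NormedAddCommGroup E] [InnerProductSpace ℂ E]
    [CompleteSpace E] {ρ : E →L[ℂ] E} (hρ : ρ.IsPositive) (x y : E) :
    ‖inner ℂ x (ρ y)‖ ≤ Real.sqrt (inner ℂ x (ρ x)).re * Real.sqrt (inner ℂ y (ρ y)).re := by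
  obtain ⟨s, hs⟩ := exists_inner_eq_of_isPositive hρ
  have h : ∀ x, Real.sqrt (inner ℂ x (ρ x)).re = ‖s x‖ := fun x => by
    rw [hs, norm_eq_sqrt_re_inner (𝕜 := ℂ)]; rfl
  rw [h, h, hs]
  exact norm_inner_le_norm _ _

theorem husimi_nonneg {ρ : FockSp J →L[ℂ] FockSp J} (hρ : ρ.IsPositive) (S : Finset J)
    (α : S → ℂ) : 0 ≤ husimi ρ S α := hρ.re_inner_nonneg_right _

theorem continuous_husimi (ρ : FockSp J →L[ℂ] FockSp J) (S : Finset J) :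
    Continuous (husimi ρ S) :=
  Complex.continuous_re.comp
    ((continuous_coherent S).inner (ρ.continuous.comp (continuous_coherent S)))

/-- The product of square roots from Cauchy-Schwarz is traded for a sum, so that each term involves
the Husimi function at one point only. -/
theorem norm_inner_coherent_le_husimi {ρ : FockSp J →L[ℂ] FockSp J} (hρ : ρ.IsPositive)
    (S : Finset J) (β α : S → ℂ) :
    ‖inner ℂ (coherent (extendAmp S β)) (ρ (coherent (extendAmp S α)))‖ ≤
      husimi ρ S α + husimi ρ S β := by
  refine (norm_inner_le_sqrt_mul_sqrt hρ _ _).trans ?_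
  change Real.sqrt (husimi ρ S β) * Real.sqrt (husimi ρ S α) ≤ _
  have h1 := Real.sq_sqrt (husimi_nonneg hρ S α)
  have h2 := Real.sq_sqrt (husimi_nonneg hρ S β)
  nlinarith [sq_nonneg (Real.sqrt (husimi ρ S β) - Real.sqrt (husimi ρ S α)),
    husimi_nonneg hρ S α, husimi_nonneg hρ S β]

theorem occProb_nonneg {ρ : FockSp J →L[ℂ] FockSp J} (hρ : ρ.IsPositive) (k : J →₀ ℕ) :
    0 ≤ occProb ρ k := hρ.re_inner_nonneg_right _

theorem entry_self {ρ : FockSp J →L[ℂ] FockSp J} (hρ : ρ.IsPositive) (k : J →₀ ℕ) :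
    entry ρ k k = occProb ρ k := by
  obtain ⟨s, hs⟩ := exists_inner_eq_of_isPositive hρ
  rw [occProb, entry, hs, inner_self_eq_norm_sq_to_K]
  norm_cast

theorem hasSum_occProb {ρ : FockSp J →L[ℂ] FockSp J} (hρ : IsDensityMatrix ρ) :
    HasSum (occProb ρ) 1 := by
  exact Complex.hasSum_re hρ.2

theorem norm_entry_le {ρ : FockSp J →L[ℂ] FockSp J} (hρ : ρ.IsPositive) (k m : J →₀ ℕ) :
    ‖entry ρ k m‖ ≤ Real.sqrt (occProb ρ k) * Real.sqrt (occProb ρ m) :=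
  norm_inner_le_sqrt_mul_sqrt hρ _ _

theorem sum_mul_le_one {ι : Type*} {A : Finset ι} {f g : ι → ℝ} (hf : ∑ i ∈ A, f i ^ 2 ≤ 1)
    (hg : ∑ i ∈ A, g i ^ 2 ≤ 1) : ∑ i ∈ A, f i * g i ≤ 1 := by
  have : ∑ i ∈ A, f i * g i ≤ ∑ i ∈ A, (f i ^ 2 + g i ^ 2) / 2 :=
    Finset.sum_le_sum fun i _ => by nlinarith [sq_nonneg (f i - g i)]
  rw [← Finset.sum_div, Finset.sum_add_distrib] at this
  linarith

theorem sum_norm_coherentAmp_sq_le (S : Finset J) (α : S → ℂ) (A : Finset (J →₀ ℕ)) :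
    ∑ n ∈ A, ‖coherentAmp (extendAmp S α) n‖ ^ 2 ≤ 1 := by
  have := lp.sum_rpow_le_norm_rpow (p := 2) (by norm_num) (coherent (extendAmp S α)) A
  rw [norm_coherent] at this
  simpa [coherent] using this

theorem sum_sqrt_occProb_mul_le {ρ : FockSp J →L[ℂ] FockSp J} (hρ : IsDensityMatrix ρ)
    (S : Finset J) (α : S → ℂ) (A : Finset (J →₀ ℕ)) :
    ∑ n ∈ A, Real.sqrt (occProb ρ n) * ‖coherentAmp (extendAmp S α) n‖ ≤ 1 := by
  refine sum_mul_le_one ?_ (sum_norm_coherentAmp_sq_le S α A)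
  simp only [Real.sq_sqrt (occProb_nonneg hρ.1 _)]
  exact sum_le_hasSum A (fun n _ => occProb_nonneg hρ.1 n) (hasSum_occProb hρ)

theorem sum_prod_mul_le_one {ι κ : Type*} {u : ι → ℝ} {v : κ → ℝ} (hu0 : ∀ i, 0 ≤ u i)
    (hv0 : ∀ i, 0 ≤ v i) (hu : ∀ A : Finset ι, ∑ i ∈ A, u i ≤ 1)
    (hv : ∀ A : Finset κ, ∑ i ∈ A, v i ≤ 1) (A : Finset (ι × κ)) :
    ∑ q ∈ A, u q.1 * v q.2 ≤ 1 := by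
  classical
  calc ∑ q ∈ A, u q.1 * v q.2
      ≤ ∑ q ∈ A.image Prod.fst ×ˢ A.image Prod.snd, u q.1 * v q.2 :=
        Finset.sum_le_sum_of_subset_of_nonneg Finset.subset_product
          fun _ _ _ => mul_nonneg (hu0 _) (hv0 _)
    _ = (∑ i ∈ A.image Prod.fst, u i) * ∑ i ∈ A.image Prod.snd, v i := by
        rw [Finset.sum_mul_sum, Finset.sum_product]
    _ ≤ 1 := mul_le_one₀ (hu _) (Finset.sum_nonneg fun _ _ => hv0 _) (hv _)

theorem hasSum_mul_of_sum_norm_le {ι κ : Type*} {f : ι → ℂ} {g : κ → ℂ} {s t : ℂ} {C : ℝ}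
    (hf : HasSum f s) (hg : HasSum g t)
    (hb : ∀ A : Finset (ι × κ), ∑ q ∈ A, ‖f q.1 * g q.2‖ ≤ C) :
    HasSum (fun q : ι × κ => f q.1 * g q.2) (s * t) :=
  hf.mul hg (Summable.of_norm (summable_of_sum_le (fun _ => norm_nonneg _) hb))

/-- The bound `|ρ_km| ≤ √p_k √p_m` lets the double sum factor; each factor is at most 1 by trace one
and unit norm. Uniformity in the amplitudes is what later permits termwise integration. -/
theorem sum_norm_entry_coherentAmp_le {ρ : FockSp J →L[ℂ] FockSp J} (hρ : IsDensityMatrix ρ)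
    (S : Finset J) (β α : S → ℂ) (A : Finset ((J →₀ ℕ) × (J →₀ ℕ))) :
    ∑ q ∈ A, ‖conj (coherentAmp (extendAmp S β) q.1) * entry ρ q.1 q.2 *
      coherentAmp (extendAmp S α) q.2‖ ≤ 1 := by
  refine le_trans (Finset.sum_le_sum fun q _ => ?_) (sum_prod_mul_le_one
    (fun _ => mul_nonneg (Real.sqrt_nonneg _) (norm_nonneg _))
    (fun _ => mul_nonneg (Real.sqrt_nonneg _) (norm_nonneg _))
    (sum_sqrt_occProb_mul_le hρ S β) (sum_sqrt_occProb_mul_le hρ S α) A)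
  rw [norm_mul, norm_mul, RCLike.norm_conj]
  have := mul_le_mul_of_nonneg_left (norm_entry_le hρ.1 q.1 q.2)
    (mul_nonneg (norm_nonneg (coherentAmp (extendAmp S β) q.1))
      (norm_nonneg (coherentAmp (extendAmp S α) q.2)))
  linarith

theorem inner_numState (k : J →₀ ℕ) (ψ : FockSp J) : inner ℂ (numState k) ψ = ψ k := by
  classical
  rw [numState, lp.inner_single_left]
  simp

theorem hasSum_smul_numState (ψ : FockSp J) : HasSum (fun m => ψ m • numState m) ψ := by
  classical
  have h := lp.hasSum_single (p := 2) (by norm_num) ψ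
  refine h.congr_fun fun m => ?_
  rw [numState, ← lp.single_smul, smul_eq_mul, mul_one]

theorem hasSum_entry_mul (ρ : FockSp J →L[ℂ] FockSp J) (ψ : FockSp J) (k : J →₀ ℕ) :
    HasSum (fun m => entry ρ k m * ψ m) (ρ ψ k) := by
  have h := ((innerSL ℂ (numState k)).comp ρ).hasSum (hasSum_smul_numState ψ)
  have e : ((innerSL ℂ (numState k)).comp ρ) ψ = ρ ψ k := inner_numState k _
  rw [e] at h
  refine h.congr_fun fun m => ?_
  rw [map_smul, smul_eq_mul, mul_comm]
  rfl

/-- The double series converges absolutely, so its value can be read off from the iterated sum: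
first the expansion of `ρ|α⟩`, then the inner product. -/
theorem hasSum_entry_mul_coherentAmp {ρ : FockSp J →L[ℂ] FockSp J} (hρ : IsDensityMatrix ρ)
    (S : Finset J) (β α : S → ℂ) :
    HasSum (fun q : (J →₀ ℕ) × (J →₀ ℕ) => conj (coherentAmp (extendAmp S β) q.1) *
      entry ρ q.1 q.2 * coherentAmp (extendAmp S α) q.2)
      (inner ℂ (coherent (extendAmp S β)) (ρ (coherent (extendAmp S α)))) := by
  have hs : Summable (fun q : (J →₀ ℕ) × (J →₀ ℕ) => conj (coherentAmp (extendAmp S β) q.1) *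
      entry ρ q.1 q.2 * coherentAmp (extendAmp S α) q.2) :=
    Summable.of_norm (summable_of_sum_le (fun _ => norm_nonneg _)
      (sum_norm_entry_coherentAmp_le hρ S β α))
  obtain ⟨a, ha⟩ := hs
  have hrow := fun k => hasSum_entry_mul ρ (coherent (extendAmp S α)) k
  have hcol := ha.prod_fiberwise (g := fun k => conj (coherentAmp (extendAmp S β) k) *
      ρ (coherent (extendAmp S α)) k) fun k => by
    simp only [mul_assoc]
    exact (hrow k).mul_left (conj (coherentAmp (extendAmp S β) k))
  have h2 := lp.hasSum_inner (𝕜 := ℂ) (coherent (extendAmp S β)) (ρ (coherent (extendAmp S α)))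
  have : a = inner ℂ (coherent (extendAmp S β)) (ρ (coherent (extendAmp S α))) := by
    refine hcol.unique ?_
    convert! h2 using 2 with k
    rw [RCLike.inner_apply, mul_comm]
    rfl
  rwa [← this]

theorem hasSum_conj_coherentAmp_mul (S : Finset J) (α β : S → ℂ) :
    HasSum (fun l => conj (coherentAmp (extendAmp S α) l) * coherentAmp (extendAmp S β) l)
      (inner ℂ (coherent (extendAmp S α)) (coherent (extendAmp S β))) := by
  convert! lp.hasSum_inner (𝕜 := ℂ) (coherent (extendAmp S α)) (coherent (extendAmp S β)) using 2
  rw [RCLike.inner_apply, mul_comm]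
  rfl

/-- The summands of `⟨β|ρ|α⟩ ⟨α|β⟩` in the occupation number basis. -/
noncomputable def kernelTerm (ρ : FockSp J →L[ℂ] FockSp J) (S : Finset J) (α β : S → ℂ)
    (q : ((J →₀ ℕ) × (J →₀ ℕ)) × (J →₀ ℕ)) : ℂ :=
  (conj (coherentAmp (extendAmp S β) q.1.1) * entry ρ q.1.1 q.1.2 *
    coherentAmp (extendAmp S α) q.1.2) *
  (conj (coherentAmp (extendAmp S α) q.2) * coherentAmp (extendAmp S β) q.2)

theorem sum_norm_kernelTerm_le {ρ : FockSp J →L[ℂ] FockSp J} (hρ : IsDensityMatrix ρ)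
    (S : Finset J) (α β : S → ℂ) (A : Finset (((J →₀ ℕ) × (J →₀ ℕ)) × (J →₀ ℕ))) :
    ∑ q ∈ A, ‖kernelTerm ρ S α β q‖ ≤ 1 := by
  have h := sum_prod_mul_le_one
    (v := fun l => ‖conj (coherentAmp (extendAmp S α) l) * coherentAmp (extendAmp S β) l‖)
    (fun _ => norm_nonneg _) (fun _ => norm_nonneg _)
    (sum_norm_entry_coherentAmp_le hρ S β α) (fun A => ?_) A
  · simpa only [kernelTerm, norm_mul] using h
  simp only [norm_mul, RCLike.norm_conj]
  exact sum_mul_le_one (sum_norm_coherentAmp_sq_le S α A) (sum_norm_coherentAmp_sq_le S β A)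

theorem hasSum_kernelTerm {ρ : FockSp J →L[ℂ] FockSp J} (hρ : IsDensityMatrix ρ)
    (S : Finset J) (α β : S → ℂ) :
    HasSum (kernelTerm ρ S α β)
      (inner ℂ (coherent (extendAmp S β)) (ρ (coherent (extendAmp S α))) *
        inner ℂ (coherent (extendAmp S α)) (coherent (extendAmp S β))) := by
  have hb := sum_norm_kernelTerm_le hρ S α β
  simp only [kernelTerm] at hb
  have h := hasSum_mul_of_sum_norm_le (hasSum_entry_mul_coherentAmp hρ S β α)
    (hasSum_conj_coherentAmp_mul S α β) hb
  convert! h using 1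

theorem continuous_kernelTerm (ρ : FockSp J →L[ℂ] FockSp J) (S : Finset J)
    (q : ((J →₀ ℕ) × (J →₀ ℕ)) × (J →₀ ℕ)) :
    Continuous fun p : (S → ℂ) × (S → ℂ) => kernelTerm ρ S p.1 p.2 q := by
  have h := continuous_coherentAmp_extendAmp S
  have h1 := fun n => (h n).comp (continuous_fst (X := S → ℂ) (Y := S → ℂ))
  have h2 := fun n => (h n).comp (continuous_snd (X := S → ℂ) (Y := S → ℂ))
  have hc := Complex.continuous_conj
  exact (((hc.comp (h2 _)).mul continuous_const).mul (h1 _)).mul ((hc.comp (h1 _)).mul (h2 _))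

theorem kernelTerm_eq_zero (ρ : FockSp J →L[ℂ] FockSp J) (S : Finset J) (α β : S → ℂ)
    {q : ((J →₀ ℕ) × (J →₀ ℕ)) × (J →₀ ℕ)} (hq : q ∉ (occSet S ×ˢ occSet S) ×ˢ occSet S) :
    kernelTerm ρ S α β q = 0 := by
  unfold kernelTerm
  by_cases h1 : q.1.1 ∈ occSet S
  · by_cases h2 : q.1.2 ∈ occSet S
    · have h3 : q.2 ∉ occSet S := fun h3 => hq ⟨⟨h1, h2⟩, h3⟩
      simp [coherentAmp_extendAmp_of_notMem _ h3]
    · simp [coherentAmp_extendAmp_of_notMem _ h2]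
  · simp [coherentAmp_extendAmp_of_notMem _ h1]

end DensityMatrix

/-! ### Smeared annihilation and creation operators -/

section Operators

variable {J : Type*}

/-- The operator `∑_{i ∈ S} c_i a_i`. -/
noncomputable def lower (c : J → ℂ) (S : Finset J) (ψ : (J →₀ ℕ) → ℂ) : (J →₀ ℕ) → ℂ := fun l =>
  ∑ i ∈ S, c i * annih i ψ l

/-- The operator `∑_{i ∈ S} c_i^* a_i†`. -/
noncomputable def raise (c : J → ℂ) (S : Finset J) (ψ : (J →₀ ℕ) → ℂ) : (J →₀ ℕ) → ℂ := fun l =>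
  ∑ i ∈ S, conj (c i) * creat i ψ l

/-- The eigenvalue `∑_{i ∈ S} c_i α_i` of `lower c S` on coherent states. -/
noncomputable def smear (c : J → ℂ) (S : Finset J) (α : S → ℂ) : ℂ := ∑ i : S, c i * α i

/-- The matrix element `⟨m|:(A + A†)²:|k⟩` for `A = lower c S`. -/
noncomputable def normalSq (c : J → ℂ) (S : Finset J) (m k : J →₀ ℕ) : ℂ :=
  lower c S (lower c S (numState k)) m + 2 * raise c S (lower c S (numState k)) m +
    raise c S (raise c S (numState k)) m

theorem continuous_smear (c : J → ℂ) (S : Finset J) : Continuous (smear c S) := by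
  unfold smear; fun_prop

open Classical in
theorem numState_apply (k l : J →₀ ℕ) : (numState k : (J →₀ ℕ) → ℂ) l = if l = k then 1 else 0 := by
  rw [numState, lp.single_apply, Pi.single_apply]

theorem lower_coherentAmp (c : J → ℂ) (S : Finset J) (α : S → ℂ) :
    lower c S (coherentAmp (extendAmp S α)) =
      fun l => smear c S α * coherentAmp (extendAmp S α) l := by
  funext l
  unfold lower smear
  simp only [annih_coherentAmp, Finset.sum_mul]
  rw [← Finset.sum_coe_sort S]
  simp only [extendAmp_apply_of_mem, mul_assoc]

theorem lower_const_mul (c : J → ℂ) (S : Finset J) (z : ℂ) (ψ : (J →₀ ℕ) → ℂ) :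
    lower c S (fun l => z * ψ l) = fun l => z * lower c S ψ l := by
  funext l
  simp only [lower, annih, Finset.mul_sum]
  exact Finset.sum_congr rfl fun _ _ => by ring

theorem iterate_lower_const_mul (c : J → ℂ) (S : Finset J) (z : ℂ) (ψ : (J →₀ ℕ) → ℂ) (p : ℕ) :
    (lower c S)^[p] (fun l => z * ψ l) = fun l => z * (lower c S)^[p] ψ l := by
  induction p with
  | zero => rfl
  | succ p ih => rw [Function.iterate_succ_apply', ih, lower_const_mul, Function.iterate_succ_apply']

theorem iterate_lower_coherentAmp (c : J → ℂ) (S : Finset J) (α : S → ℂ) (p : ℕ) :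
    (lower c S)^[p] (coherentAmp (extendAmp S α)) =
      fun l => smear c S α ^ p * coherentAmp (extendAmp S α) l := by
  induction p with
  | zero => simp
  | succ p ih =>
    rw [Function.iterate_succ_apply', ih, lower_const_mul, lower_coherentAmp]
    funext l; ring

theorem finite_support_annih {χ : (J →₀ ℕ) → ℂ} (hχ : χ.support.Finite) (j : J) :
    (annih j χ).support.Finite := by
  refine (hχ.preimage (f := fun n => n + Finsupp.single j 1)
    (add_left_injective _).injOn).subset fun l hl => ?_
  exact right_ne_zero_of_mul hl

theorem finite_support_lower {χ : (J →₀ ℕ) → ℂ} (hχ : χ.support.Finite) (c : J → ℂ)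
    (S : Finset J) : (lower c S χ).support.Finite := by
  refine (S.finite_toSet.biUnion fun i _ => finite_support_annih hχ i).subset fun l hl => ?_
  obtain ⟨i, hi, h⟩ := Finset.exists_ne_zero_of_sum_ne_zero hl
  exact Set.mem_biUnion hi (right_ne_zero_of_mul h)

theorem finite_support_numState (k : J →₀ ℕ) :
    (numState k : (J →₀ ℕ) → ℂ).support.Finite := by
  classical
  refine (Set.finite_singleton k).subset fun l hl => ?_
  by_contra h
  exact hl ((numState_apply k l).trans (if_neg h))

/-- `a_j†` is the transpose of `a_j`. -/
theorem hasSum_mul_annih {ψ χ : (J →₀ ℕ) → ℂ} {j : J} {s : ℂ}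
    (h : HasSum (fun l => creat j ψ l * χ l) s) : HasSum (fun l => ψ l * annih j χ l) s := by
  -- Reindex by `l ↦ l + e_j`; the omitted terms have `l j = 0` and are killed by the factor `√(l
  -- j)`.
  rw [← (add_left_injective (Finsupp.single j 1)).hasSum_iff] at h
  · refine h.congr_fun fun l => ?_
    simp only [creat, annih, Function.comp_apply, add_tsub_cancel_right, Finsupp.add_apply,
      Finsupp.single_eq_same]
    push_cast
    ring
  · intro l hl
    have h0 : l j = 0 := by
      by_contra h0
      exact hl ⟨l - Finsupp.single j 1,
        tsub_add_cancel_of_le (Finsupp.single_le_iff.2 (Nat.one_le_iff_ne_zero.2 h0))⟩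
    simp [creat, h0]

theorem hasSum_mul_conj_lower {ψ χ : (J →₀ ℕ) → ℂ} (hχ : χ.support.Finite) (c : J → ℂ)
    (S : Finset J) {s : ℂ} (h : HasSum (fun l => raise c S ψ l * conj (χ l)) s) :
    HasSum (fun l => ψ l * conj (lower c S χ l)) s := by
  have hs : ∀ i, Summable fun l => creat i ψ l * conj (χ l) := fun i =>
    summable_of_hasFiniteSupport (hχ.subset fun l hl => by
      have := right_ne_zero_of_mul hl
      simpa using this)
  have h1 := hasSum_sum (s := S) fun i _ => (hs i).hasSum.mul_left (conj (c i))
  have h2 := hasSum_sum (s := S) fun i _ => (hasSum_mul_annih (hs i).hasSum).mul_left (conj (c i))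
  have e : s = ∑ i ∈ S, conj (c i) * ∑' l, creat i ψ l * conj (χ l) := by
    refine h.unique (h1.congr_fun fun l => ?_)
    simp only [raise, Finset.sum_mul, mul_assoc]
  rw [e]
  refine h2.congr_fun fun l => ?_
  simp only [lower, annih, map_sum, map_mul, Complex.conj_ofReal, Finset.mul_sum]
  exact Finset.sum_congr rfl fun _ _ => by ring

theorem finite_support_iterate_lower (c : J → ℂ) (S : Finset J) (m : J →₀ ℕ) (q : ℕ) :
    ((lower c S)^[q] (numState m)).support.Finite := by
  induction q with
  | zero => exact finite_support_numState m
  | succ q ih => rw [Function.iterate_succ_apply']; exact finite_support_lower ih c S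

/-- Moving `A` to the other side of the pairing turns it into `A†`. Since `A^q |m⟩` has finite
support, `ψ` may be arbitrary and no domain questions arise. -/
theorem hasSum_mul_conj_iterate_lower (c : J → ℂ) (S : Finset J) (m : J →₀ ℕ) (q : ℕ)
    (ψ : (J →₀ ℕ) → ℂ) :
    HasSum (fun l => ψ l * conj ((lower c S)^[q] (numState m) l)) ((raise c S)^[q] ψ m) := by
  classical
  induction q generalizing ψ with
  | zero =>
    convert! hasSum_single (f := fun l => ψ l * conj ((numState m : (J →₀ ℕ) → ℂ) l)) m ?_ using 1
    · simp [numState_apply]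
    · intro l hl
      simp [numState_apply, hl]
  | succ q ih =>
    rw [Function.iterate_succ_apply']
    exact hasSum_mul_conj_lower (finite_support_iterate_lower c S m q) c S (ih _)

theorem mem_occSet_iff {S : Finset J} {n : J →₀ ℕ} : n ∈ occSet S ↔ ∀ j, n j ≠ 0 → j ∈ S :=
  ⟨fun h _ hj => h (Finsupp.mem_support_iff.2 hj), fun h _ hj => h _ (Finsupp.mem_support_iff.1 hj)⟩

theorem annih_numState_eq {i : J} {k l : J →₀ ℕ} (h : annih i (numState k) l ≠ 0) :
    k = l + Finsupp.single i 1 := by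
  classical
  have := right_ne_zero_of_mul h
  rw [numState_apply] at this
  by_contra hk
  exact this (if_neg fun h => hk h.symm)

theorem creat_ne_zero {i : J} {ψ : (J →₀ ℕ) → ℂ} {l : J →₀ ℕ} (h : creat i ψ l ≠ 0) :
    l i ≠ 0 ∧ ψ (l - Finsupp.single i 1) ≠ 0 := by
  refine ⟨fun h0 => h ?_, right_ne_zero_of_mul h⟩
  simp [creat, h0]

/-- Two lowerings or two raisings cannot return to `k`, so only `2 A†A` contributes. The
nonnegativity of this value is the source of the moment bounds. -/
theorem normalSq_self {c : J → ℂ} {S : Finset J} (k : J →₀ ℕ) :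
    normalSq c S k k = ((2 * ∑ i ∈ S, ‖c i‖ ^ 2 * k i : ℝ) : ℂ) := by
  classical
  have h1 : lower c S (lower c S (numState k)) k = 0 := by
    refine Finset.sum_eq_zero fun i _ => ?_
    rw [annih, lower, Finset.sum_eq_zero, mul_zero, mul_zero]
    intro j _
    rw [mul_eq_zero]
    right
    by_contra h
    have := DFunLike.congr_fun (annih_numState_eq h) i
    simp only [Finsupp.add_apply, Finsupp.single_eq_same] at this
    omega
  have h2 : raise c S (raise c S (numState k)) k = 0 := by
    refine Finset.sum_eq_zero fun i _ => ?_
    rw [mul_eq_zero]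
    right
    by_contra h
    obtain ⟨hi, h⟩ := creat_ne_zero h
    obtain ⟨j, -, h⟩ := Finset.exists_ne_zero_of_sum_ne_zero h
    obtain ⟨-, h⟩ := creat_ne_zero (right_ne_zero_of_mul h)
    rw [numState_apply] at h
    have h3 : k - Finsupp.single i 1 - Finsupp.single j 1 = k := by
      by_contra h4
      exact h (if_neg h4)
    have := DFunLike.congr_fun h3 i
    simp only [Finsupp.tsub_apply, Finsupp.single_eq_same] at this
    omega
  have h3 : raise c S (lower c S (numState k)) k = ((∑ i ∈ S, ‖c i‖ ^ 2 * k i : ℝ) : ℂ) := by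
    rw [Complex.ofReal_sum]
    refine Finset.sum_congr rfl fun i hi => ?_
    by_cases hki : k i = 0
    · simp [creat, hki]
    have hsub : k - Finsupp.single i 1 + Finsupp.single i 1 = k :=
      tsub_add_cancel_of_le (Finsupp.single_le_iff.2 (Nat.one_le_iff_ne_zero.2 hki))
    have h4 : lower c S (numState k) (k - Finsupp.single i 1) = c i * (Real.sqrt (k i) : ℂ) := by
      rw [lower, Finset.sum_eq_single i]
      · rw [annih, hsub, numState_apply, if_pos rfl, mul_one, ← Nat.cast_add_one]
        congr 4
        simp only [Finsupp.tsub_apply, Finsupp.single_eq_same]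
        omega
      · intro j _ hj
        rw [mul_eq_zero]
        right
        by_contra h
        have := DFunLike.congr_fun (annih_numState_eq h) i
        simp only [Finsupp.add_apply, Finsupp.tsub_apply, Finsupp.single_eq_same,
          Finsupp.single_apply, if_neg hj] at this
        omega
      · exact fun h => absurd hi h
    rw [creat, h4]
    have h5 : (Real.sqrt (k i) : ℂ) * (Real.sqrt (k i) : ℂ) = k i := by
      rw [← Complex.ofReal_mul, Real.mul_self_sqrt (by positivity)]; simp
    push_cast
    rw [← h5, ← Complex.conj_mul']
    ring
  rw [normalSq, h1, h2, h3]
  push_cast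
  ring

end Operators

/-! ### The stress tensor as a normal ordered square -/

section Stress

variable {M : Type*} [TopologicalSpace M] [ChartedSpace ModelSpace M]
  {J : Type*}

/-- Every annihilated mode must be occupied in `k` and every created mode in `m`, so only pairs from
`S × S` survive. The two mixed terms agree after exchanging the summation indices, whence the factor
2. -/
theorem stressMatrix_eq_normalSq {f : J → M → ℂ} {x : M} {n : TangentSpace 𝓘(ℝ, ModelSpace) x}
    (hconj : ∀ j, dirDeriv (conjFun (f j)) x n = conj (dirDeriv (f j) x n))
    {S : Finset J} {m k : J →₀ ℕ} (hm : m ∈ occSet S) (hk : k ∈ occSet S) :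
    stressMatrix f x n m k = normalSq (fun j => dirDeriv (f j) x n) S m k := by
  rw [mem_occSet_iff] at hm hk
  have hterm : ∀ p : J × J, p ∉ S ×ˢ S →
      annih p.1 (annih p.2 (numState k)) m = 0 ∧ creat p.2 (annih p.1 (numState k)) m = 0 ∧
      creat p.1 (annih p.2 (numState k)) m = 0 ∧ creat p.1 (creat p.2 (numState k)) m = 0 := by
    rintro ⟨i, j⟩ hp
    have hca : ∀ i j, creat j (annih i (numState k)) m ≠ 0 → i ∈ S ∧ j ∈ S := by
      intro i j h
      obtain ⟨h1, h2⟩ := creat_ne_zero h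
      refine ⟨hk i ?_, hm j h1⟩
      rw [annih_numState_eq h2]
      simp
    refine ⟨?_, ?_, ?_, ?_⟩ <;> by_contra h <;> apply hp <;> rw [Finset.mem_product]
    · have h1 := annih_numState_eq (right_ne_zero_of_mul h)
      constructor
      · exact hk i (by rw [h1]; simp)
      · exact hk j (by rw [h1]; simp)
    · exact hca _ _ h
    · exact (hca _ _ h).symm
    · obtain ⟨h1, h2⟩ := creat_ne_zero h
      obtain ⟨h3, -⟩ := creat_ne_zero h2
      refine ⟨hm i h1, hm j fun h0 => h3 ?_⟩
      simp [h0]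
  have h2 : raise (fun j => dirDeriv (f j) x n) S
      (lower (fun j => dirDeriv (f j) x n) S (numState k)) m =
      ∑ i ∈ S, ∑ j ∈ S, dirDeriv (f i) x n * conj (dirDeriv (f j) x n) *
        creat j (annih i (numState k)) m := by
    rw [Finset.sum_comm]
    simp only [raise, lower, creat, Finset.mul_sum]
    exact Finset.sum_congr rfl fun _ _ => Finset.sum_congr rfl fun _ _ => by ring
  unfold stressMatrix
  rw [tsum_eq_sum (s := S ×ˢ S) fun p hp => by
    obtain ⟨h1, h2, h3, h4⟩ := hterm p hp
    rw [h1, h2, h3, h4]; simp, Finset.sum_product]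
  simp only [nullProd, hconj, Finset.sum_add_distrib]
  rw [normalSq, two_mul]
  nth_rewrite 1 [h2]
  rw [← add_assoc]
  congr 1
  · congr 1
    · congr 1
      simp only [lower, annih, Finset.mul_sum]
      exact Finset.sum_congr rfl fun _ _ => Finset.sum_congr rfl fun _ _ => by ring
    · simp only [raise, lower, creat, Finset.mul_sum]
      exact Finset.sum_congr rfl fun _ _ => Finset.sum_congr rfl fun _ _ => by ring
  · simp only [raise, creat, Finset.mul_sum]
    exact Finset.sum_congr rfl fun _ _ => Finset.sum_congr rfl fun _ _ => by ring

end Stress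

/-! ### Integrals over polydiscs -/

section PolydiscIntegrals

variable {J : Type*}

open Classical in
/-- The squared norm of the amplitude `⟨n|α⟩` over the polydisc of radius `R`. -/
noncomputable def polydiscWeight (S : Finset J) (R : ℝ) (n : J →₀ ℕ) : ℝ :=
  if n ∈ occSet S then Real.pi ^ S.card * occWeight S R n else 0

theorem polydiscWeight_nonneg (S : Finset J) (R : ℝ) (n : J →₀ ℕ) :
    0 ≤ polydiscWeight S R n := by
  unfold polydiscWeight
  split_ifs
  · exact mul_nonneg (by positivity) (occWeight_nonneg S R n)
  · exact le_rfl

theorem polydiscWeight_le (S : Finset J) (R : ℝ) (n : J →₀ ℕ) :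
    polydiscWeight S R n ≤ Real.pi ^ S.card := by
  unfold polydiscWeight
  split_ifs
  · exact mul_le_of_le_one_right (by positivity) (occWeight_le_one S R n)
  · positivity

-- The Kronecker delta is written as a number state so that `lower` can act on its second index.
open Classical in
theorem setIntegral_conj_coherentAmp_mul' (S : Finset J) {R : ℝ} (hR : 0 ≤ R) (k l : J →₀ ℕ) :
    ∫ α in Metric.closedBall (0 : S → ℂ) R,
      conj (coherentAmp (extendAmp S α) k) * coherentAmp (extendAmp S α) l =
    polydiscWeight S R k * (numState k : (J →₀ ℕ) → ℂ) l := by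
  rw [setIntegral_conj_coherentAmp_mul S hR, numState_apply, polydiscWeight]
  by_cases h1 : k = l <;> by_cases h2 : k ∈ occSet S <;> simp [h1, h2, eq_comm]
  · subst h1; simp [h2]
  · subst h1; simp [h2]

theorem integrable_lower {X : Type*} [MeasurableSpace X] {μ : Measure X}
    {ψ : X → (J →₀ ℕ) → ℂ} (h : ∀ l, Integrable (fun x => ψ x l) μ) (c : J → ℂ) (S : Finset J)
    (l : J →₀ ℕ) : Integrable (fun x => lower c S (ψ x) l) μ :=
  integrable_finsetSum _ fun _ _ => ((h _).const_mul _).const_mul _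

theorem integral_lower {X : Type*} [MeasurableSpace X] {μ : Measure X}
    {ψ : X → (J →₀ ℕ) → ℂ} (h : ∀ l, Integrable (fun x => ψ x l) μ) (c : J → ℂ) (S : Finset J) :
    (fun l => ∫ x, lower c S (ψ x) l ∂μ) = lower c S (fun l => ∫ x, ψ x l ∂μ) := by
  funext l
  unfold lower annih
  rw [integral_finsetSum _ fun _ _ => ((h _).const_mul _).const_mul _]
  simp only [integral_const_mul]

theorem integral_iterate_lower {X : Type*} [MeasurableSpace X] {μ : Measure X}
    {ψ : X → (J →₀ ℕ) → ℂ} (h : ∀ l, Integrable (fun x => ψ x l) μ) (c : J → ℂ) (S : Finset J)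
    (p : ℕ) :
    (fun l => ∫ x, (lower c S)^[p] (ψ x) l ∂μ) = (lower c S)^[p] (fun l => ∫ x, ψ x l ∂μ) := by
  induction p generalizing ψ with
  | zero => rfl
  | succ p ih =>
    simp only [Function.iterate_succ_apply]
    rw [ih (integrable_lower h c S), integral_lower h]

theorem continuous_conj_coherentAmp_extendAmp (S : Finset J) (n : J →₀ ℕ) :
    Continuous fun α : S → ℂ => conj (coherentAmp (extendAmp S α) n) :=
  Complex.continuous_conj.comp (continuous_coherentAmp_extendAmp S n)

/-- The polynomial factor is an eigenvalue: it is produced by letting `A^p` act on the index `l`. As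
a finite combination of shifts, `A^p` commutes with the integral and then acts on the delta left by
orthogonality. -/
theorem setIntegral_conj_coherentAmp_mul_smear (S : Finset J) {R : ℝ} (hR : 0 ≤ R) (c : J → ℂ)
    (p : ℕ) (k l : J →₀ ℕ) :
    ∫ α in Metric.closedBall (0 : S → ℂ) R,
      conj (coherentAmp (extendAmp S α) k) * (smear c S α ^ p * coherentAmp (extendAmp S α) l) =
    polydiscWeight S R k * (lower c S)^[p] (numState k) l := by
  have h := congrFun (integral_iterate_lower (μ := volume.restrict (Metric.closedBall 0 R))
    (ψ := fun (α : S → ℂ) l =>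
      conj (coherentAmp (extendAmp S α) k) * coherentAmp (extendAmp S α) l)
    (fun l => ((continuous_conj_coherentAmp_extendAmp S k).mul
      (continuous_coherentAmp_extendAmp S l)).continuousOn.integrableOn_compact
        (isCompact_closedBall 0 R)) c S p) l
  simp only [setIntegral_conj_coherentAmp_mul' S hR, iterate_lower_const_mul] at h
  rw [← h]
  simp only [iterate_lower_coherentAmp]

/-- Integral of a single term in the expansion of `⟨β|ρ|α⟩ ⟨α|β⟩`. -/
theorem setIntegral_kernelTerm_mul_smear (ρ : FockSp J →L[ℂ] FockSp J) (S : Finset J) {R : ℝ}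
    (hR : 0 ≤ R) (c : J → ℂ) (p q : ℕ) (k m l : J →₀ ℕ) :
    ∫ z in Metric.closedBall (0 : S → ℂ) R ×ˢ Metric.closedBall (0 : S → ℂ) R,
      kernelTerm ρ S z.1 z.2 ((k, m), l) * (smear c S z.2 ^ p * conj (smear c S z.1) ^ q) =
    polydiscWeight S R k * polydiscWeight S R m * entry ρ k m *
      ((lower c S)^[p] (numState k) l * conj ((lower c S)^[q] (numState m) l)) := by
  have h := setIntegral_prod_mul (μ := (volume : Measure (S → ℂ)))
    (ν := (volume : Measure (S → ℂ)))
    (fun α => conj (conj (coherentAmp (extendAmp S α) m) *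
      (smear c S α ^ q * coherentAmp (extendAmp S α) l)))
    (fun β => conj (coherentAmp (extendAmp S β) k) *
      (smear c S β ^ p * coherentAmp (extendAmp S β) l))
    (Metric.closedBall (0 : S → ℂ) R) (Metric.closedBall (0 : S → ℂ) R)
  rw [integral_conj, setIntegral_conj_coherentAmp_mul_smear S hR,
    setIntegral_conj_coherentAmp_mul_smear S hR] at h
  have e : ∀ z : (S → ℂ) × (S → ℂ),
      kernelTerm ρ S z.1 z.2 ((k, m), l) * (smear c S z.2 ^ p * conj (smear c S z.1) ^ q) =
      entry ρ k m * (conj (conj (coherentAmp (extendAmp S z.1) m) *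
        (smear c S z.1 ^ q * coherentAmp (extendAmp S z.1) l)) *
      (conj (coherentAmp (extendAmp S z.2) k) *
        (smear c S z.2 ^ p * coherentAmp (extendAmp S z.2) l))) := by
    intro z
    simp only [kernelTerm, map_mul, map_pow, Complex.conj_conj]
    ring
  simp only [e]
  rw [integral_const_mul, Measure.volume_eq_prod, h, map_mul, Complex.conj_ofReal]
  ring

/-- The square expands into powers `p + q = 2`, with `A^p` acting on `|k⟩` and `A^q` on `|m⟩`.
Summing over `l` transposes the latter, giving `(A†)^q A^p`: normal ordering appears by itself. -/
theorem hasSum_setIntegral_kernelTerm (ρ : FockSp J →L[ℂ] FockSp J) (S : Finset J) {R : ℝ}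
    (hR : 0 ≤ R) (c : J → ℂ) (k m : J →₀ ℕ) :
    HasSum (fun l => ∫ z in Metric.closedBall (0 : S → ℂ) R ×ˢ Metric.closedBall (0 : S → ℂ) R,
      kernelTerm ρ S z.1 z.2 ((k, m), l) * (smear c S z.2 + conj (smear c S z.1)) ^ 2)
      (polydiscWeight S R k * polydiscWeight S R m * (entry ρ k m * normalSq c S m k)) := by
  have hint : ∀ (p q : ℕ) (l : J →₀ ℕ), IntegrableOn (fun z : (S → ℂ) × (S → ℂ) =>
      kernelTerm ρ S z.1 z.2 ((k, m), l) * (smear c S z.2 ^ p * conj (smear c S z.1) ^ q))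
      (Metric.closedBall (0 : S → ℂ) R ×ˢ Metric.closedBall (0 : S → ℂ) R) := by
    intro p q l
    refine ContinuousOn.integrableOn_compact
      ((isCompact_closedBall _ _).prod (isCompact_closedBall _ _)) (Continuous.continuousOn ?_)
    have h := continuous_smear c S
    exact (continuous_kernelTerm ρ S _).mul (((h.comp continuous_snd).pow p).mul
      ((Complex.continuous_conj.comp (h.comp continuous_fst)).pow q))
  have e : ∀ l, ∫ z in Metric.closedBall (0 : S → ℂ) R ×ˢ Metric.closedBall (0 : S → ℂ) R,
      kernelTerm ρ S z.1 z.2 ((k, m), l) * (smear c S z.2 + conj (smear c S z.1)) ^ 2 =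
      polydiscWeight S R k * polydiscWeight S R m * entry ρ k m *
      ((lower c S)^[2] (numState k) l * conj ((lower c S)^[0] (numState m) l)) +
      2 * (polydiscWeight S R k * polydiscWeight S R m * entry ρ k m *
      ((lower c S)^[1] (numState k) l * conj ((lower c S)^[1] (numState m) l))) +
      polydiscWeight S R k * polydiscWeight S R m * entry ρ k m *
      ((lower c S)^[0] (numState k) l * conj ((lower c S)^[2] (numState m) l)) := by
    intro l
    rw [← setIntegral_kernelTerm_mul_smear ρ S hR, ← setIntegral_kernelTerm_mul_smear ρ S hR,
      ← setIntegral_kernelTerm_mul_smear ρ S hR, ← integral_const_mul,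
      ← integral_add' (hint 2 0 l) ((hint 1 1 l).const_mul 2),
      ← integral_add' (Integrable.add (hint 2 0 l) ((hint 1 1 l).const_mul 2)) (hint 0 2 l)]
    refine integral_congr_ae (Eventually.of_forall fun z => ?_)
    simp only [Pi.add_apply]
    ring
  simp only [e]
  have h := fun p q => hasSum_mul_conj_iterate_lower c S m q ((lower c S)^[p] (numState k))
  have h3 := (((h 2 0).add ((h 1 1).mul_left 2)).add (h 0 2)).mul_left
    (polydiscWeight S R k * polydiscWeight S R m * entry ρ k m : ℂ)
  convert! h3 using 1
  · funext l; ring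
  · simp only [normalSq, Function.iterate_succ, Function.iterate_zero, Function.comp_apply, id]
    ring

/-- The smeared double integral of `⟨β|ρ|α⟩ ⟨α|β⟩` over polydiscs as a sum over occupation
numbers. -/
theorem hasSum_polydisc {ρ : FockSp J →L[ℂ] FockSp J} (hρ : IsDensityMatrix ρ) (S : Finset J)
    {R : ℝ} (hR : 0 ≤ R) (c : J → ℂ) :
    HasSum (fun q : (J →₀ ℕ) × (J →₀ ℕ) => (polydiscWeight S R q.1 * polydiscWeight S R q.2 : ℂ) *
        (entry ρ q.1 q.2 * normalSq c S q.2 q.1))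
      (∫ z in Metric.closedBall (0 : S → ℂ) R ×ˢ Metric.closedBall (0 : S → ℂ) R,
        (inner ℂ (coherent (extendAmp S z.2)) (ρ (coherent (extendAmp S z.1))) *
          inner ℂ (coherent (extendAmp S z.1)) (coherent (extendAmp S z.2))) *
          (smear c S z.2 + conj (smear c S z.1)) ^ 2) := by
  have hG : Continuous fun z : (S → ℂ) × (S → ℂ) =>
      (smear c S z.2 + conj (smear c S z.1)) ^ 2 :=
    (((continuous_smear c S).comp continuous_snd).add
      (Complex.continuous_conj.comp ((continuous_smear c S).comp continuous_fst))).pow 2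
  have h := hasSum_setIntegral_of_sum_norm_le (μ := volume)
    ((isCompact_closedBall (0 : S → ℂ) R).prod (isCompact_closedBall (0 : S → ℂ) R))
    (F := fun q z => kernelTerm ρ S z.1 z.2 q * (smear c S z.2 + conj (smear c S z.1)) ^ 2)
    (fun q => (continuous_kernelTerm ρ S q).mul hG) hG.norm
    (((countable_occSet S).prod (countable_occSet S)).prod (countable_occSet S))
    (fun q hq => by funext z; simp [kernelTerm_eq_zero ρ S z.1 z.2 hq])
    (fun A z => by
      simp only [norm_mul, ← Finset.sum_mul]
      exact mul_le_of_le_one_left (norm_nonneg _) (sum_norm_kernelTerm_le hρ S z.1 z.2 A))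
    (fun z => (hasSum_kernelTerm hρ S z.1 z.2).mul_right _)
  -- The index `l` comes from the inserted resolution of `⟨α|β⟩` and is summed first.
  exact h.prod_fiberwise fun q => hasSum_setIntegral_kernelTerm ρ S hR c q.1 q.2

end PolydiscIntegrals

/-! ### Absolute convergence of the coherent state integrals -/

section Integrability

variable {J : Type*}

theorem inner_coherent_eq_husimi {ρ : FockSp J →L[ℂ] FockSp J} (hρ : ρ.IsPositive) (S : Finset J)
    (α : S → ℂ) :
    inner ℂ (coherent (extendAmp S α)) (ρ (coherent (extendAmp S α))) = husimi ρ S α := by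
  obtain ⟨s, hs⟩ := exists_inner_eq_of_isPositive hρ
  rw [husimi, hs, inner_self_eq_norm_sq_to_K]
  norm_cast

theorem hasSum_setIntegral_husimi_mul {ρ : FockSp J →L[ℂ] FockSp J} (hρ : IsDensityMatrix ρ)
    (S : Finset J) (R : ℝ) {w : (S → ℂ) → ℝ} (hw : Continuous w) :
    HasSum (fun q : (J →₀ ℕ) × (J →₀ ℕ) => entry ρ q.1 q.2 *
      ∫ α in Metric.closedBall (0 : S → ℂ) R, conj (coherentAmp (extendAmp S α) q.1) *
        coherentAmp (extendAmp S α) q.2 * w α)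
      (∫ α in Metric.closedBall (0 : S → ℂ) R, (husimi ρ S α * w α : ℂ)) := by
  have hw' : Continuous fun α => (w α : ℂ) := Complex.continuous_ofReal.comp hw
  have h := hasSum_setIntegral_of_sum_norm_le (μ := volume) (isCompact_closedBall (0 : S → ℂ) R)
    (F := fun (q : (J →₀ ℕ) × (J →₀ ℕ)) α => (conj (coherentAmp (extendAmp S α) q.1) *
      entry ρ q.1 q.2 * coherentAmp (extendAmp S α) q.2) * w α)
    (fun q => (((continuous_conj_coherentAmp_extendAmp S _).mul continuous_const).mul
      (continuous_coherentAmp_extendAmp S _)).mul hw') hw'.norm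
    ((countable_occSet S).prod (countable_occSet S))
    (fun q hq => by
      funext α
      by_cases h1 : q.1 ∈ occSet S
      · have h2 : q.2 ∉ occSet S := fun h2 => hq ⟨h1, h2⟩
        simp [coherentAmp_extendAmp_of_notMem _ h2]
      · simp [coherentAmp_extendAmp_of_notMem _ h1])
    (fun A α => by
      simp only [norm_mul _ (w α : ℂ), ← Finset.sum_mul]
      exact mul_le_of_le_one_left (norm_nonneg _) (sum_norm_entry_coherentAmp_le hρ S α α A))
    (fun α => (hasSum_entry_mul_coherentAmp hρ S α α).mul_right _)
  simp only [inner_coherent_eq_husimi hρ.1] at h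
  refine h.congr_fun fun q => ?_
  rw [← integral_const_mul]
  refine integral_congr_ae (Eventually.of_forall fun α => ?_)
  ring

/-- A weight is integrable against the Husimi function if it is diagonal in the occupation number
basis and its expectation value is finite. -/
theorem integrable_husimi_mul {ρ : FockSp J →L[ℂ] FockSp J} (hρ : IsDensityMatrix ρ)
    (S : Finset J) {w : (S → ℂ) → ℝ} (hw : Continuous w) (hw0 : ∀ α, 0 ≤ w α)
    {b : (J →₀ ℕ) → ℝ}
    (hoff : ∀ R : ℝ, 0 ≤ R → ∀ k m, k ≠ m → ∫ α in Metric.closedBall (0 : S → ℂ) R,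
      conj (coherentAmp (extendAmp S α) k) * coherentAmp (extendAmp S α) m * w α = 0)
    (hdiag : ∀ R : ℝ, 0 ≤ R → ∀ k, ‖∫ α in Metric.closedBall (0 : S → ℂ) R,
      conj (coherentAmp (extendAmp S α) k) * coherentAmp (extendAmp S α) k * w α‖ ≤ b k)
    (hb : Summable fun k => occProb ρ k * b k) :
    Integrable fun α => husimi ρ S α * w α := by
  have hcont : Continuous fun α => husimi ρ S α * w α := (continuous_husimi ρ S).mul hw
  -- The integrand is nonnegative, so a bound on its integrals over balls, uniform in the radius, is
  -- enough.
  refine (aecover_closedBall (μ := volume) (x := (0 : S → ℂ))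
    (tendsto_natCast_atTop_atTop (R := ℝ))).integrable_of_integral_norm_bounded
      (∑' k, occProb ρ k * b k)
      (fun N => hcont.continuousOn.integrableOn_compact (isCompact_closedBall _ _))
      (Eventually.of_forall fun N => ?_)
  have h := hasSum_setIntegral_husimi_mul hρ S N hw
  have hinj : Function.Injective fun k : J →₀ ℕ => (k, k) := fun _ _ h => (Prod.ext_iff.1 h).1
  rw [← hinj.hasSum_iff] at h
  · have h2 := h.norm_le_of_bounded hb.hasSum fun k => by
      rw [Function.comp_apply, norm_mul, entry_self hρ.1, Complex.norm_real,
        Real.norm_of_nonneg (occProb_nonneg hρ.1 k)]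
      exact mul_le_mul_of_nonneg_left (hdiag N (Nat.cast_nonneg N) k) (occProb_nonneg hρ.1 k)
    have e : ∫ α in Metric.closedBall (0 : S → ℂ) N, (husimi ρ S α * w α : ℂ) =
        ((∫ α in Metric.closedBall (0 : S → ℂ) N, ‖husimi ρ S α * w α‖ : ℝ) : ℂ) := by
      rw [← integral_complex_ofReal]
      refine integral_congr_ae (Eventually.of_forall fun α => ?_)
      simp only [Real.norm_of_nonneg (mul_nonneg (husimi_nonneg hρ.1 S α) (hw0 α))]
      push_cast
      rfl
    rw [e, Complex.norm_real] at h2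
    exact (le_abs_self _).trans h2
  · intro q hq
    have : q.1 ≠ q.2 := fun h => hq ⟨q.1, Prod.ext rfl h⟩
    rw [hoff N (Nat.cast_nonneg N) _ _ this, mul_zero]

theorem integrable_husimi {ρ : FockSp J →L[ℂ] FockSp J} (hρ : IsDensityMatrix ρ)
    (S : Finset J) : Integrable (husimi ρ S) := by
  classical
  have h := integrable_husimi_mul hρ S (w := fun _ => 1) (b := fun _ => Real.pi ^ S.card)
    continuous_const (fun _ => zero_le_one)
    (fun R hR k m hkm => by
      simp only [Complex.ofReal_one, mul_one]
      rw [setIntegral_conj_coherentAmp_mul' S hR, numState_apply, if_neg (Ne.symm hkm), mul_zero])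
    (fun R hR k => by
      simp only [Complex.ofReal_one, mul_one]
      rw [setIntegral_conj_coherentAmp_mul' S hR, numState_apply, if_pos rfl, mul_one,
        Complex.norm_real, Real.norm_of_nonneg (polydiscWeight_nonneg S R k)]
      exact polydiscWeight_le S R k)
    ((hasSum_occProb hρ).summable.mul_right _)
  simpa using h

theorem mul_coherentAmp_extendAmp {S : Finset J} (α : S → ℂ) (i : S) (k : J →₀ ℕ) :
    α i * coherentAmp (extendAmp S α) k =
      Real.sqrt (k i + 1) * coherentAmp (extendAmp S α) (k + Finsupp.single (i : J) 1) := by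
  have h := congrFun (annih_coherentAmp (extendAmp S α) i) k
  rw [extendAmp_apply_of_mem] at h
  exact h.symm

/-- Each factor of `|α i|²` is absorbed into one amplitude by raising its occupation number, so the
weight stays diagonal. Keeping `a` inside the moment hypothesis means that nothing is required of
modes with `a = 0`. -/
theorem integrable_husimi_mul_normSq {ρ : FockSp J →L[ℂ] FockSp J} (hρ : IsDensityMatrix ρ)
    (S : Finset J) (i : S) {a : ℝ} (ha : 0 ≤ a)
    (hmom : Summable fun k => occProb ρ k * (a * k i)) :
    Integrable fun α => husimi ρ S α * (a * ‖α i‖ ^ 2) := by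
  classical
  have key : ∀ R : ℝ, 0 ≤ R → ∀ k m : J →₀ ℕ, ∫ α in Metric.closedBall (0 : S → ℂ) R,
      conj (coherentAmp (extendAmp S α) k) * coherentAmp (extendAmp S α) m *
        ((a * ‖α i‖ ^ 2 : ℝ) : ℂ) =
      (a * Real.sqrt (k i + 1) * Real.sqrt (m i + 1)) *
        (polydiscWeight S R (k + Finsupp.single (i : J) 1) * if m = k then 1 else 0) := by
    intro R hR k m
    have e : ∀ α : S → ℂ, conj (coherentAmp (extendAmp S α) k) * coherentAmp (extendAmp S α) m *
        ((a * ‖α i‖ ^ 2 : ℝ) : ℂ) = (a * Real.sqrt (k i + 1) * Real.sqrt (m i + 1)) *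
        (conj (coherentAmp (extendAmp S α) (k + Finsupp.single (i : J) 1)) *
          coherentAmp (extendAmp S α) (m + Finsupp.single (i : J) 1)) := by
      intro α
      have h1 := mul_coherentAmp_extendAmp α i m
      have h2 := congrArg conj (mul_coherentAmp_extendAmp α i k)
      rw [map_mul, map_mul, Complex.conj_ofReal] at h2
      push_cast
      rw [← Complex.conj_mul']
      linear_combination (a : ℂ) * (α i * coherentAmp (extendAmp S α) m) * h2 +
        (a : ℂ) * (Real.sqrt (k i + 1) *
          conj (coherentAmp (extendAmp S α) (k + Finsupp.single (i : J) 1))) * h1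
    simp only [e]
    rw [integral_const_mul, setIntegral_conj_coherentAmp_mul' S hR, numState_apply]
    simp only [add_left_inj]
  -- Husimi averages are antinormally ordered: `|α i|²` corresponds to `a_i a_i†`, hence `k i + 1`.
  -- The extra 1 is paid for by the trace.
  refine integrable_husimi_mul hρ S (b := fun k => a * (k i + 1) * Real.pi ^ S.card)
    (by fun_prop) (fun α => by positivity)
    (fun R hR k m hkm => by rw [key R hR, if_neg (Ne.symm hkm), mul_zero, mul_zero])
    (fun R hR k => ?_) ?_
  · rw [key R hR, if_pos rfl, mul_one, mul_assoc (a : ℂ), ← Complex.ofReal_mul,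
      Real.mul_self_sqrt (by positivity), ← Complex.ofReal_mul, ← Complex.ofReal_mul,
      Complex.norm_real, Real.norm_of_nonneg (mul_nonneg (by positivity)
        (polydiscWeight_nonneg S R _))]
    exact mul_le_mul_of_nonneg_left (polydiscWeight_le S R _) (by positivity)
  · have h := (hmom.add ((hasSum_occProb hρ).summable.mul_right a)).mul_right (Real.pi ^ S.card)
    refine h.congr fun k => ?_
    ring

/-- The weight `∑_{i ∈ S} |c_i|² |α_i|²`. -/
noncomputable def ampWeight (c : J → ℂ) (S : Finset J) (α : S → ℂ) : ℝ := ∑ i : S, ‖c i‖ ^ 2 * ‖α i‖ ^ 2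

theorem ampWeight_nonneg (c : J → ℂ) (S : Finset J) (α : S → ℂ) : 0 ≤ ampWeight c S α :=
  Finset.sum_nonneg fun _ _ => by positivity

theorem continuous_ampWeight (c : J → ℂ) (S : Finset J) : Continuous (ampWeight c S) := by
  unfold ampWeight; fun_prop

theorem integrable_husimi_mul_ampWeight {ρ : FockSp J →L[ℂ] FockSp J} (hρ : IsDensityMatrix ρ)
    (S : Finset J) {c : J → ℂ} (hmom : ∀ i, Summable fun k => occProb ρ k * (‖c i‖ ^ 2 * k i)) :
    Integrable fun α => husimi ρ S α * (1 + ampWeight c S α) := by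
  have h := (integrable_husimi hρ S).add (integrable_finsetSum Finset.univ fun (i : S) _ =>
    integrable_husimi_mul_normSq hρ S i (by positivity) (hmom i))
  refine h.congr (Eventually.of_forall fun α => ?_)
  simp only [Pi.add_apply, ampWeight, mul_add, Finset.mul_sum, mul_one]

/-- Half of the Gaussian exponent absorbs the quadratic weight, through `s / 4 ≤ exp (s / 4) - 1`;
the other half is a product of integrable one-mode Gaussians. -/
theorem integrable_gaussian_mul_ampWeight (c : J → ℂ) (S : Finset J) :
    Integrable fun α : S → ℂ => Real.exp (-(∑ j, ‖α j‖ ^ 2) / 2) * (1 + ampWeight c S α) := by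
  have h1 : Integrable fun z : ℂ => Real.exp (-‖z‖ ^ 2 / 4) := by
    have h := Complex.integral_exp_neg_mul_rpow (p := 2) (b := 1 / 4) (by norm_num) (by norm_num)
    have h2 : Integrable fun z : ℂ => Real.exp (-(1 / 4) * ‖z‖ ^ (2 : ℝ)) :=
      Integrable.of_integral_ne_zero (by rw [h]; norm_num)
    refine h2.congr (Eventually.of_forall fun z => ?_)
    simp only [Real.rpow_ofNat]
    congr 1
    ring
  have h2 : Integrable fun α : S → ℂ => ∏ j, Real.exp (-‖α j‖ ^ 2 / 4) :=
    Integrable.fintype_prod (f := fun (_ : S) z => Real.exp (-‖z‖ ^ 2 / 4)) fun _ => h1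
  set C : ℝ := ∑ i : S, ‖c i‖ ^ 2 with hC
  refine (h2.const_mul (1 + 4 * C)).mono' ?_ (Eventually.of_forall fun α => ?_)
  · have := continuous_ampWeight c S
    exact Continuous.aestronglyMeasurable (by fun_prop)
  · have hs : 0 ≤ ∑ j, ‖α j‖ ^ 2 := Finset.sum_nonneg fun _ _ => by positivity
    have hC0 : 0 ≤ C := Finset.sum_nonneg fun _ _ => by positivity
    have hW : ampWeight c S α ≤ C * ∑ j, ‖α j‖ ^ 2 := by
      rw [ampWeight, hC, Finset.sum_mul]
      refine Finset.sum_le_sum fun i _ => mul_le_mul_of_nonneg_left ?_ (by positivity)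
      exact Finset.single_le_sum (f := fun j => ‖α j‖ ^ 2) (fun _ _ => by positivity)
        (Finset.mem_univ i)
    rw [← Real.exp_sum, ← Finset.sum_div, Finset.sum_neg_distrib, Real.norm_of_nonneg
      (mul_nonneg (Real.exp_pos _).le (by linarith [ampWeight_nonneg c S α]))]
    set s := ∑ j, ‖α j‖ ^ 2
    have h3 : Real.exp (-s / 2) = Real.exp (-s / 4) * Real.exp (-(s / 4)) := by
      rw [← Real.exp_add]; congr 1; ring
    have h4 : (1 + ampWeight c S α) ≤ (1 + 4 * C) * Real.exp (s / 4) := by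
      have h5 := Real.add_one_le_exp (s / 4)
      have h6 : C * (s / 4) ≤ C * (Real.exp (s / 4) - 1) :=
        mul_le_mul_of_nonneg_left (by linarith) hC0
      nlinarith
    calc Real.exp (-s / 2) * (1 + ampWeight c S α)
        ≤ Real.exp (-s / 2) * ((1 + 4 * C) * Real.exp (s / 4)) :=
          mul_le_mul_of_nonneg_left h4 (Real.exp_pos _).le
      _ = (1 + 4 * C) * Real.exp (-s / 4) := by
          rw [h3, Real.exp_neg]
          field_simp

theorem norm_smear_sq_le (c : J → ℂ) (S : Finset J) (α : S → ℂ) :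
    ‖smear c S α‖ ^ 2 ≤ S.card * ampWeight c S α := by
  have h1 : ‖smear c S α‖ ≤ ∑ i : S, ‖c i‖ * ‖α i‖ := by
    refine (norm_sum_le _ _).trans (Finset.sum_le_sum fun _ _ => (norm_mul _ _).le)
  have h2 := sq_sum_le_card_mul_sum_sq (s := Finset.univ) (f := fun i : S => ‖c i‖ * ‖α i‖)
  simp only [mul_pow, Finset.card_univ, Fintype.card_coe] at h2
  exact (pow_le_pow_left₀ (norm_nonneg _) h1 2).trans h2

theorem ampWeight_le_of_sub (c : J → ℂ) (S : Finset J) (α β : S → ℂ) :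
    ampWeight c S α ≤ 2 * ampWeight c S β + 2 * ampWeight c S (α - β) := by
  unfold ampWeight
  rw [Finset.mul_sum, Finset.mul_sum, ← Finset.sum_add_distrib]
  refine Finset.sum_le_sum fun i _ => ?_
  have h1 : ‖α i‖ ≤ ‖β i‖ + ‖(α - β) i‖ := by
    have := norm_add_le (β i) ((α - β) i)
    simpa using this
  have h2 : ‖α i‖ ^ 2 ≤ 2 * ‖β i‖ ^ 2 + 2 * ‖(α - β) i‖ ^ 2 := by
    nlinarith [norm_nonneg (α i), sq_nonneg (‖β i‖ - ‖(α - β) i‖)]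
  nlinarith [mul_le_mul_of_nonneg_left h2 (sq_nonneg ‖c i‖)]

/-- The integrand `⟨β|ρ|α⟩ ⟨α|β⟩ (∑_i c_i β_i + c_i^* α_i^*)²`. -/
noncomputable def overlapIntegrand (ρ : FockSp J →L[ℂ] FockSp J) (c : J → ℂ) (S : Finset J)
    (z : (S → ℂ) × (S → ℂ)) : ℂ :=
  (inner ℂ (coherent (extendAmp S z.2)) (ρ (coherent (extendAmp S z.1))) *
    inner ℂ (coherent (extendAmp S z.1)) (coherent (extendAmp S z.2))) *
    (smear c S z.2 + conj (smear c S z.1)) ^ 2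

theorem continuous_overlapIntegrand (ρ : FockSp J →L[ℂ] FockSp J) (c : J → ℂ) (S : Finset J) :
    Continuous (overlapIntegrand ρ c S) := by
  have h1 := (continuous_coherent S).comp (continuous_fst (X := S → ℂ) (Y := S → ℂ))
  have h2 := (continuous_coherent S).comp (continuous_snd (X := S → ℂ) (Y := S → ℂ))
  have h3 := (continuous_smear c S).comp (continuous_fst (X := S → ℂ) (Y := S → ℂ))
  have h4 := (continuous_smear c S).comp (continuous_snd (X := S → ℂ) (Y := S → ℂ))
  exact ((h2.inner (ρ.continuous.comp h1)).mul (h1.inner h2)).mul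
    ((h4.add (Complex.continuous_conj.comp h3)).pow 2)

/-- Eliminating `α` in favour of `β` and `α - β` makes the bound a product of a function of `β` and
one of the difference, as a convolution requires. -/
theorem smear_sq_le (c : J → ℂ) (S : Finset J) (α β : S → ℂ) :
    ‖(smear c S β + conj (smear c S α)) ^ 2‖ ≤
      6 * S.card * ((1 + ampWeight c S β) * (1 + ampWeight c S (α - β))) := by
  have h1 := norm_add_le (smear c S β) (conj (smear c S α))
  rw [RCLike.norm_conj] at h1
  have h2 := norm_smear_sq_le c S α
  have h3 := norm_smear_sq_le c S β
  have h4 := mul_le_mul_of_nonneg_left (ampWeight_le_of_sub c S α β)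
    (Nat.cast_nonneg (α := ℝ) S.card)
  have h5 : ‖smear c S β + conj (smear c S α)‖ ^ 2 ≤
      2 * (‖smear c S β‖ ^ 2 + ‖smear c S α‖ ^ 2) := by
    nlinarith [norm_nonneg (smear c S β + conj (smear c S α)),
      sq_nonneg (‖smear c S β‖ - ‖smear c S α‖)]
  rw [norm_pow]
  have h6 : 3 * ampWeight c S β + 2 * ampWeight c S (α - β) ≤
      3 * ((1 + ampWeight c S β) * (1 + ampWeight c S (α - β))) := by
    nlinarith [ampWeight_nonneg c S β, ampWeight_nonneg c S (α - β),
      mul_nonneg (ampWeight_nonneg c S β) (ampWeight_nonneg c S (α - β))]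
  have h7 := mul_le_mul_of_nonneg_left h6 (Nat.cast_nonneg (α := ℝ) S.card)
  nlinarith

theorem integrable_overlapIntegrand {ρ : FockSp J →L[ℂ] FockSp J} (hρ : IsDensityMatrix ρ)
    (S : Finset J) {c : J → ℂ} (hmom : ∀ i, Summable fun k => occProb ρ k * (‖c i‖ ^ 2 * k i)) :
    Integrable (overlapIntegrand ρ c S) := by
  have h1 := (integrable_husimi_mul_ampWeight hρ S hmom).convolution_integrand
    (ContinuousLinearMap.mul ℝ ℝ) (integrable_gaussian_mul_ampWeight c S)
  -- `h1` treats the Husimi function at `β`, its swap the one at `α`.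
  have h2 := h1.swap
  rw [← Measure.volume_eq_prod] at h1 h2
  refine ((h1.add h2).const_mul (6 * (S.card : ℝ))).mono'
    (continuous_overlapIntegrand ρ c S).aestronglyMeasurable (Eventually.of_forall ?_)
  rintro ⟨α, β⟩
  simp only [Function.comp_apply, Prod.swap_prod_mk, ContinuousLinearMap.mul_apply', Pi.add_apply,
    overlapIntegrand, Pi.sub_apply]
  rw [norm_mul, norm_mul, norm_inner_coherent]
  have hE : Real.exp (-(∑ j, ‖β j - α j‖ ^ 2) / 2) = Real.exp (-(∑ j, ‖α j - β j‖ ^ 2) / 2) := by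
    simp only [norm_sub_rev]
  have hG1 := smear_sq_le c S α β
  -- Conjugation exchanges the roles of `α` and `β` without changing the norm.
  have hG2 : ‖(smear c S β + conj (smear c S α)) ^ 2‖ ≤
      6 * S.card * ((1 + ampWeight c S α) * (1 + ampWeight c S (β - α))) := by
    have := smear_sq_le c S β α
    rwa [norm_pow, ← RCLike.norm_conj, map_add, RCLike.conj_conj, add_comm, ← norm_pow] at this
  have hQ := norm_inner_coherent_le_husimi hρ.1 S β α
  rw [hE]
  set E := Real.exp (-(∑ j, ‖α j - β j‖ ^ 2) / 2) with hEdef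
  have hE0 : 0 ≤ E := (Real.exp_pos _).le
  have hA := husimi_nonneg hρ.1 S α
  have hB := husimi_nonneg hρ.1 S β
  calc _ ≤ (husimi ρ S α + husimi ρ S β) * E * ‖(smear c S β + conj (smear c S α)) ^ 2‖ := by
        gcongr
    _ = husimi ρ S β * E * ‖(smear c S β + conj (smear c S α)) ^ 2‖ +
        husimi ρ S α * E * ‖(smear c S β + conj (smear c S α)) ^ 2‖ := by ring
    _ ≤ husimi ρ S β * E * (6 * S.card * ((1 + ampWeight c S β) * (1 + ampWeight c S (α - β)))) +
        husimi ρ S α * E *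
          (6 * S.card * ((1 + ampWeight c S α) * (1 + ampWeight c S (β - α)))) := by
        gcongr
    _ = _ := by ring

open Classical in
/-- The double integral over coherent states of the modes in `S` is a trace over their occupation
numbers. -/
theorem integral_overlapIntegrand {ρ : FockSp J →L[ℂ] FockSp J} (hρ : IsDensityMatrix ρ)
    (S : Finset J) {c : J → ℂ} (hmom : ∀ i, Summable fun k => occProb ρ k * (‖c i‖ ^ 2 * k i))
    (hsum : Summable ((occSet S ×ˢ occSet S).indicator
      fun q : (J →₀ ℕ) × (J →₀ ℕ) => entry ρ q.1 q.2 * normalSq c S q.2 q.1)) :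
    ∫ z, overlapIntegrand ρ c S z = (Real.pi ^ (2 * S.card) : ℝ) *
      ∑' q, (occSet S ×ˢ occSet S).indicator
        (fun q : (J →₀ ℕ) × (J →₀ ℕ) => entry ρ q.1 q.2 * normalSq c S q.2 q.1) q := by
  have hL := (aecover_closedBall (μ := volume) (x := (0 : (S → ℂ) × (S → ℂ)))
    (tendsto_natCast_atTop_atTop (R := ℝ))).integral_tendsto_of_countably_generated
      (integrable_overlapIntegrand hρ S hmom)
  have hterm : ∀ (R : ℝ) (q : (J →₀ ℕ) × (J →₀ ℕ)),
      (polydiscWeight S R q.1 * polydiscWeight S R q.2 : ℂ) *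
        (entry ρ q.1 q.2 * normalSq c S q.2 q.1) =
      ((Real.pi ^ (2 * S.card) : ℝ) * (occWeight S R q.1 * occWeight S R q.2 : ℝ)) *
        (occSet S ×ˢ occSet S).indicator
        (fun q : (J →₀ ℕ) × (J →₀ ℕ) => entry ρ q.1 q.2 * normalSq c S q.2 q.1) q := by
    intro R q
    unfold polydiscWeight
    by_cases h1 : q.1 ∈ occSet S
    · by_cases h2 : q.2 ∈ occSet S
      · rw [if_pos h1, if_pos h2, Set.indicator_of_mem (Set.mk_mem_prod h1 h2)]
        push_cast
        ring
      · rw [if_neg h2, Set.indicator_of_notMem fun h => h2 h.2]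
        simp
    · rw [if_neg h1, Set.indicator_of_notMem fun h => h1 h.1]
      simp
  have hS : ∀ N : ℕ, ∫ z in Metric.closedBall (0 : (S → ℂ) × (S → ℂ)) N, overlapIntegrand ρ c S z =
      ∑' q, ((Real.pi ^ (2 * S.card) : ℝ) * (occWeight S N q.1 * occWeight S N q.2 : ℝ)) *
        (occSet S ×ˢ occSet S).indicator
        (fun q : (J →₀ ℕ) × (J →₀ ℕ) => entry ρ q.1 q.2 * normalSq c S q.2 q.1) q := by
    intro N
    have h := (hasSum_polydisc hρ S (Nat.cast_nonneg N) c).tsum_eq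
    simp only [hterm] at h
    rw [h, closedBall_prod_same]
    rfl
  simp only [hS] at hL
  refine tendsto_nhds_unique hL ?_
  rw [← tsum_mul_left]
  -- The weights lie in `[0, 1]` and tend to 1, so the truncated trace series itself dominates.
  refine tendsto_tsum_of_dominated_convergence (hsum.norm.mul_left (Real.pi ^ (2 * S.card)))
    (fun q => ?_) (Eventually.of_forall fun N q => ?_)
  · have h := ((tendsto_occWeight S q.1).mul (tendsto_occWeight S q.2)).ofReal
    have h2 := (h.const_mul ((Real.pi ^ (2 * S.card) : ℝ) : ℂ)).mul_const
      ((occSet S ×ˢ occSet S).indicator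
        (fun q : (J →₀ ℕ) × (J →₀ ℕ) => entry ρ q.1 q.2 * normalSq c S q.2 q.1) q)
    simpa only [mul_one, Complex.ofReal_one] using h2
  · rw [norm_mul, norm_mul, Complex.norm_real, Complex.norm_real,
      Real.norm_of_nonneg (by positivity), Real.norm_of_nonneg
        (mul_nonneg (occWeight_nonneg S N q.1) (occWeight_nonneg S N q.2))]
    refine mul_le_mul_of_nonneg_right (mul_le_of_le_one_right (by positivity) ?_) (norm_nonneg _)
    exact mul_le_one₀ (occWeight_le_one S N q.1) (occWeight_nonneg S N q.2)
      (occWeight_le_one S N q.2)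

end Integrability

/-! ### The null energy condition in the coherent state representation -/

section DirectionalDerivative

variable {M : Type*} [TopologicalSpace M] [ChartedSpace ModelSpace M]

theorem dirDeriv_comp_continuousLinearMap {f : M → ℂ} {x : M}
    (hf : MDifferentiableAt 𝓘(ℝ, ModelSpace) 𝓘(ℝ, ℂ) f x) (L : ℂ →L[ℝ] ℂ)
    (n : TangentSpace 𝓘(ℝ, ModelSpace) x) :
    dirDeriv (fun y => L (f y)) x n = L (dirDeriv f x n) := by
  have h := (L.hasMFDerivAt (x := f x)).comp x hf.hasMFDerivAt
  unfold dirDeriv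
  change mfderiv _ _ (L ∘ f) x n = _
  rw [h.mfderiv]
  rfl

theorem mdifferentiableAt_comp_continuousLinearMap {f : M → ℂ} {x : M}
    (hf : MDifferentiableAt 𝓘(ℝ, ModelSpace) 𝓘(ℝ, ℂ) f x) (L : ℂ →L[ℝ] ℂ) :
    MDifferentiableAt 𝓘(ℝ, ModelSpace) 𝓘(ℝ, ℂ) (fun y => L (f y)) x :=
  ((L.hasMFDerivAt (x := f x)).comp x hf.hasMFDerivAt).mdifferentiableAt

theorem dirDeriv_conjFun {f : M → ℂ} {x : M}
    (hf : MDifferentiableAt 𝓘(ℝ, ModelSpace) 𝓘(ℝ, ℂ) f x)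
    (n : TangentSpace 𝓘(ℝ, ModelSpace) x) :
    dirDeriv (conjFun f) x n = conj (dirDeriv f x n) :=
  dirDeriv_comp_continuousLinearMap hf Complex.conjCLE.toContinuousLinearMap n

theorem dirDeriv_sum {ι : Type*} (A : Finset ι) {f : ι → M → ℂ} {x : M}
    (hf : ∀ i ∈ A, MDifferentiableAt 𝓘(ℝ, ModelSpace) 𝓘(ℝ, ℂ) (f i) x)
    (n : TangentSpace 𝓘(ℝ, ModelSpace) x) :
    dirDeriv (fun y => ∑ i ∈ A, f i y) x n = ∑ i ∈ A, dirDeriv (f i) x n := by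
  classical
  suffices h : MDifferentiableAt 𝓘(ℝ, ModelSpace) 𝓘(ℝ, ℂ) (fun y => ∑ i ∈ A, f i y) x ∧
      dirDeriv (fun y => ∑ i ∈ A, f i y) x n = ∑ i ∈ A, dirDeriv (f i) x n from h.2
  induction A using Finset.induction_on with
  | empty =>
    simp only [Finset.sum_empty]
    refine ⟨mdifferentiableAt_const, ?_⟩
    rw [dirDeriv, mfderiv_const]
    rfl
  | insert i A hi ih =>
    obtain ⟨h1, h2⟩ := ih fun j hj => hf j (Finset.mem_insert_of_mem hj)
    have h := (hf i (Finset.mem_insert_self i A)).hasMFDerivAt.add h1.hasMFDerivAt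
    have e : (fun y => ∑ j ∈ insert i A, f j y) = f i + fun y => ∑ j ∈ A, f j y := by
      funext y
      rw [Finset.sum_insert hi, Pi.add_apply]
    rw [e, Finset.sum_insert hi, ← h2]
    exact ⟨h.mdifferentiableAt, by rw [dirDeriv, h.mfderiv]; rfl⟩

variable {J : Type*}

theorem dirDeriv_crossFun {f : J → M → ℂ} {x : M}
    (hf : ∀ j, MDifferentiableAt 𝓘(ℝ, ModelSpace) 𝓘(ℝ, ℂ) (f j) x)
    (n : TangentSpace 𝓘(ℝ, ModelSpace) x) (S : Finset J) (α β : S → ℂ) :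
    dirDeriv (crossFun f (extendAmp S α) (extendAmp S β)) x n =
      smear (fun j => dirDeriv (f j) x n) S β + conj (smear (fun j => dirDeriv (f j) x n) S α) := by
  -- Each mode enters through a real-linear map of `f j`, which handles the function and its
  -- conjugate together.
  set L : S → ℂ →L[ℝ] ℂ := fun j => (β j) • ContinuousLinearMap.id ℝ ℂ +
    (conj (α j)) • (Complex.conjCLE : ℂ →L[ℝ] ℂ) with hL
  have e : crossFun f (extendAmp S α) (extendAmp S β) = fun y => ∑ j : S, L j (f j y) := by
    funext y
    rw [crossFun, finsum_eq_sum_of_support_subset (s := S), ← Finset.sum_coe_sort]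
    · refine Finset.sum_congr rfl fun j _ => ?_
      simp only [extendAmp_apply_of_mem, hL]
      simp [mul_comm]
    · intro j hj
      by_contra h
      exact hj (by simp [extendAmp_apply_of_notMem _ (show j ∉ S from h)])
  rw [e, dirDeriv_sum _ fun (j : S) _ => mdifferentiableAt_comp_continuousLinearMap (hf j) (L j)]
  simp only [dirDeriv_comp_continuousLinearMap (hf _)]
  simp only [smear, map_sum, map_mul, ← Finset.sum_add_distrib]
  refine Finset.sum_congr rfl fun j _ => ?_
  simp [hL, mul_comm]

end DirectionalDerivative

/-! ### The double sum as a null energy expectation value -/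

section NullEnergy

variable {M : Type*} [TopologicalSpace M] [ChartedSpace ModelSpace M] {J : Type*}

/-- The Gaussian equals `⟨β|α⟩ ⟨α|β⟩`; its first factor cancels the nonzero denominator of
`coherentRatio`. -/
theorem coherentIntegrand_eq (ρ : FockSp J →L[ℂ] FockSp J) {f : J → M → ℂ} {x : M}
    (hf : ∀ j, MDifferentiableAt 𝓘(ℝ, ModelSpace) 𝓘(ℝ, ℂ) (f j) x)
    (n : TangentSpace 𝓘(ℝ, ModelSpace) x) (S : Finset J) (z : (S → ℂ) × (S → ℂ)) :
    coherentIntegrand ρ f x n S z =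
      (overlapIntegrand ρ (fun j => dirDeriv (f j) x n) S z).re := by
  obtain ⟨α, β⟩ := z
  simp only [coherentIntegrand, coherentTerm, coherentRatio, nullProd, overlapIntegrand,
    dirDeriv_crossFun hf, extendAmp_sub, ampNormSq_extendAmp]
  rw [← Complex.re_mul_ofReal]
  congr 1
  have h1 : ((Real.exp (-∑ j, ‖(α - β) j‖ ^ 2) : ℝ) : ℂ) =
      inner ℂ (coherent (extendAmp S β)) (coherent (extendAmp S α)) *
        inner ℂ (coherent (extendAmp S α)) (coherent (extendAmp S β)) := by
    rw [← inner_conj_symm (coherent (extendAmp S α)), Complex.mul_conj', norm_inner_coherent]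
    norm_cast
    rw [← Real.exp_nat_mul]
    congr 1
    simp only [Pi.sub_apply, norm_sub_rev (β _)]
    push_cast
    ring
  have h2 : inner ℂ (coherent (extendAmp S β)) (coherent (extendAmp S α)) ≠ 0 := by
    rw [← norm_ne_zero_iff, norm_inner_coherent]
    exact (Real.exp_pos _).ne'
  rw [h1]
  field_simp

/-- The occupation numbers of modes with non-vanishing derivative have finite mean. -/
theorem summable_occProb_mul {ρ : FockSp J →L[ℂ] FockSp J} (hρ : ρ.IsPositive)
    {f : J → M → ℂ} {x : M} {n : TangentSpace 𝓘(ℝ, ModelSpace) x}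
    (hconj : ∀ j, dirDeriv (conjFun (f j)) x n = conj (dirDeriv (f j) x n))
    (hT : Summable (stressTraceTerm ρ f x n)) (i : J) :
    Summable fun k => occProb ρ k * (‖dirDeriv (f i) x n‖ ^ 2 * k i) := by
  have hinj : Function.Injective fun k : J →₀ ℕ => (k, k) := fun _ _ h => (Prod.ext_iff.1 h).1
  refine Summable.of_nonneg_of_le
    (fun k => mul_nonneg (occProb_nonneg hρ k) (by positivity)) (fun k => ?_)
    (hT.comp_injective hinj).norm
  -- On the diagonal, taking `S` to be the support of `k` already captures every contributing mode.
  have h1 : stressTraceTerm ρ f x n (k, k) = ((occProb ρ k *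
      (2 * ∑ i ∈ k.support, ‖dirDeriv (f i) x n‖ ^ 2 * k i) : ℝ) : ℂ) := by
    have hk : k ∈ occSet k.support := Finset.Subset.refl _
    change entry ρ k k * _ = _
    rw [entry_self hρ, stressMatrix_eq_normalSq hconj hk hk, normalSq_self]
    push_cast
    rfl
  have h0 : 0 ≤ ∑ i ∈ k.support, ‖dirDeriv (f i) x n‖ ^ 2 * (k i : ℝ) :=
    Finset.sum_nonneg fun _ _ => by positivity
  have h2 : ‖dirDeriv (f i) x n‖ ^ 2 * (k i : ℝ) ≤
      2 * ∑ i ∈ k.support, ‖dirDeriv (f i) x n‖ ^ 2 * (k i : ℝ) := by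
    by_cases hi : i ∈ k.support
    · have := Finset.single_le_sum (f := fun i => ‖dirDeriv (f i) x n‖ ^ 2 * (k i : ℝ))
        (fun _ _ => by positivity) hi
      linarith
    · rw [Finsupp.notMem_support_iff.1 hi]
      simpa using h0
  rw [Function.comp_apply, h1, Complex.norm_real, Real.norm_of_nonneg
    (mul_nonneg (occProb_nonneg hρ k) (by positivity))]
  exact mul_le_mul_of_nonneg_left h2 (occProb_nonneg hρ k)

/-- The double sum over coherent states is the null energy expectation value. -/
theorem coherentDoubleSum_stressExpectation {ρ : FockSp J →L[ℂ] FockSp J}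
    (hρ : IsDensityMatrix ρ) {f : J → M → ℂ} {x : M}
    (hf : ∀ j, MDifferentiableAt 𝓘(ℝ, ModelSpace) 𝓘(ℝ, ℂ) (f j) x)
    {n : TangentSpace 𝓘(ℝ, ModelSpace) x} (hT : Summable (stressTraceTerm ρ f x n)) :
    CoherentDoubleSum ρ f x n (stressExpectation ρ f x n).re := by
  classical
  have hconj := fun j => dirDeriv_conjFun (hf j) n
  have hmom := summable_occProb_mul hρ.1 hconj hT
  have hind : ∀ S : Finset J, ((occSet S ×ˢ occSet S).indicator
      fun q : (J →₀ ℕ) × (J →₀ ℕ) =>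
        entry ρ q.1 q.2 * normalSq (fun j => dirDeriv (f j) x n) S q.2 q.1) =
      (occSet S ×ˢ occSet S).indicator (stressTraceTerm ρ f x n) := by
    intro S
    refine Set.indicator_congr fun q hq => ?_
    rw [stressTraceTerm, stressMatrix_eq_normalSq hconj hq.2 hq.1]
    rfl
  have hint := fun S => integrable_overlapIntegrand hρ S hmom
  have hfun : ∀ S, coherentIntegrand ρ f x n S =
      fun z => (overlapIntegrand ρ (fun j => dirDeriv (f j) x n) S z).re := fun S =>
    funext (coherentIntegrand_eq ρ hf n S)
  refine ⟨fun S => by rw [hfun]; exact (hint S).re, ?_⟩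
  have hval : ∀ S : Finset J, (Real.pi ^ (2 * S.card))⁻¹ * ∫ α, coherentIntegrand ρ f x n S α =
      (∑' q, (occSet S ×ˢ occSet S).indicator (stressTraceTerm ρ f x n) q).re := by
    intro S
    have h := integral_overlapIntegrand hρ S hmom (by rw [hind]; exact hT.indicator _)
    rw [hind] at h
    have h2 : ∫ z, (overlapIntegrand ρ (fun j => dirDeriv (f j) x n) S z).re =
        (∫ z, overlapIntegrand ρ (fun j => dirDeriv (f j) x n) S z).re := integral_re (hint S)
    rw [hfun, h2, h, Complex.re_ofReal_mul, inv_mul_cancel_left₀ (by positivity)]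
  simp only [hval]
  refine (Complex.continuous_re.tendsto _).comp
    (tendsto_tsum_of_dominated_convergence hT.norm (fun q => ?_)
      (Eventually.of_forall fun S q => norm_indicator_le_norm_self _ _))
  -- Each trace term is eventually constant in `S`, namely once `S` contains the supports of both
  -- occupation numbers.
  refine tendsto_const_nhds.congr' ?_
  filter_upwards [eventually_ge_atTop (q.1.support ∪ q.2.support)] with S hS
  rw [Set.indicator_of_mem]
  exact ⟨Finset.subset_union_left.trans hS, Finset.subset_union_right.trans hS⟩

theorem CoherentDoubleSum.unique {ρ : FockSp J →L[ℂ] FockSp J} {f : J → M → ℂ} {x : M}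
    {n : TangentSpace 𝓘(ℝ, ModelSpace) x} {L L' : ℝ} (h : CoherentDoubleSum ρ f x n L)
    (h' : CoherentDoubleSum ρ f x n L') : L = L' := by
  classical
  exact tendsto_nhds_unique h.2 h'.2

end NullEnergy

theorem mainTheorem5 {M : Type*} [TopologicalSpace M] [ChartedSpace ModelSpace M]
    [IsManifold 𝓘(ℝ, ModelSpace) ∞ M] (g : LorentzianMetric M)
    {J : Type*} (f : J → M → ℂ) (hf : ∀ j, IsKleinGordonSolution g (f j))
    (ρ : FockSp J →L[ℂ] FockSp J) (hρ : IsDensityMatrix ρ)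
    (hT : HasStressExpectation g ρ f) :
    (∀ (x : M) (n : TangentSpace 𝓘(ℝ, ModelSpace) x), g.IsNull x n →
      ∃ L : ℝ, CoherentDoubleSum ρ f x n L) ∧
    (ViolatesNEC g ρ f ↔
      ∃ (x : M) (n : TangentSpace 𝓘(ℝ, ModelSpace) x) (L : ℝ),
        g.IsNull x n ∧ CoherentDoubleSum ρ f x n L ∧ L < 0) := by
  have key : ∀ (x : M) (n : TangentSpace 𝓘(ℝ, ModelSpace) x), g.IsNull x n →
      CoherentDoubleSum ρ f x n (stressExpectation ρ f x n).re := fun x n hn =>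
    coherentDoubleSum_stressExpectation hρ
      (fun j => (hf j).1.mdifferentiableAt (by simp)) (hT x n hn)
  refine ⟨fun x n hn => ⟨_, key x n hn⟩, ?_, ?_⟩
  · rintro ⟨x, n, hn, h⟩
    exact ⟨x, n, _, hn, key x n hn, h⟩
  · rintro ⟨x, n, L, hn, hL, h⟩
    exact ⟨x, n, hn, (key x n hn).unique hL ▸ h⟩
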